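/- **Setting.** All vector norms are Euclidean and all matrix norms are the induced 2-norms. Let $T\in\mathbb N$, $A_t\in\mathbb R^{n\times n}$ and $B_t\in\mathbb R^{n\times m}$ for $0\le t\le T-1$, and let $f_t:\mathbb R^n\to\mathbb R$, $c_t:\mathbb R^m\to\mathbb R$ for $1\le t\le T$. Call a differentiable function $g$ $\mu$-strongly convex (resp. $\ell$-strongly smooth) if $g(y)\ge g(x)+\langle\nabla g(x),y-x\rangle+\frac{\mu}{2}\|y-x\|^2$ (resp. $g(y)\le g(x)+\langle\nabla g(x),y-x\rangle+\frac{\ell}{2}\|y-x\|^2$) for all $x,y$. **Assumptions.** (i) There are constants $m_f,\ell_f,m_c,\ell_c>0$ such that $f_t$ is $m_f$-strongly convex for $1\le t\le T$ and $\ell_f$-strongly smooth for $1\le t\le T-1$; $c_t$ is $m_c$-strongly convex and $\ell_c$-strongly smooth for $1\le t\le T$; and, for $1\le t\le T$, $f_t$ and $c_t$ are twice continuously differentiable, non-negative, and satisfy $f_t(0)=c_t(0)=0$. (ii) There are constants $a,b,\sigma>0$ and an integer $d\ge 1$ such that $\|A_t\|\le a$ and $\|B_t\|\le b$ for $0\le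 t\le T-1$, and for all $0\le t\le T-d$ the $n$ largest singular values of the $n\times md$ controllability matrix $$M(t,d)=[\Phi(t+d,t+1)B_t,\ \Phi(t+d,t+2)B_{t+1},\ \dots,\ \Phi(t+d,t+d)B_{t+d-1}]$$ are at least $\sigma$ (that is, $M(t,d)$ has full row rank and $\sigma_{\min}(M(t,d))\ge\sigma$). Here $\Phi(t_2,t_1)=A_{t_2-1}\cdots A_{t_1}$ if $t_2>t_1$ and $\Phi(t_2,t_1)=I$ otherwise. (iii) $F:\mathbb R^n\to\mathbb R\cup\{+\infty\}$ is either the indicator function of the origin ($0$ at $0$, $+\infty$ elsewhere) or a real-valued, non-negative, convex, twice continuously differentiable function with $F(0)=0$. **The problems.** For $p\ge1$, $t\ge 0$ with $t+p\le T$, $x\in\mathbb R^n$ and $\zeta=(\zeta_0,\dots,\zeta_{p-1})\in(\mathbb R^n)^p$, consider the trajectories $(y_{0:p},v_{0:p-1})$ with $$y_0=x,\qquad y_\tau=A_{t+\tau-1}y_{\tau-1}+B_{t+\tau-1}v_{\tau-1}+\zeta_{\tau-1}\quad(1\le\tau\le p).$$ Let $\tilde\psi_t^p(x,\zeta;F)$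 be the one minimizing $\sum_{\tau=1}^p f_{t+\tau}(y_\tau)+\sum_{\tau=1}^p c_{t+\tau}(v_{\tau-1})+F(y_p)$, and let $\psi_t^p(x,\zeta,z)$ be the one minimizing $\sum_{\tau=1}^p f_{t+\tau}(y_\tau)+\sum_{\tau=1}^p c_{t+\tau}(v_{\tau-1})$ subject in addition to $y_p=z$. The subscript $y_h$ denotes the state $y_h$ of the optimal trajectory. **Constants.** Let $\ell=\max(\ell_f,\ell_c)$. For $a\ne1$ let $$C(p)=\Big(\tfrac{b(a^{p+1}+a-2)}{\sigma^2(a-1)}\sqrt{\tfrac{a^{2p}-1}{a^2-1}}+\tfrac{1+b}{b}\Big)\Big(\tfrac{b\sqrt{a^{2p+2}-(p+1)a^2+p}}{|a^2-1|}+1\Big)+\sqrt{\tfrac{a^{2p+2}-1}{a^2-1}}-\tfrac1b,$$ and for $a=1$ let $$C(p)=\Big(\tfrac{b\sqrt p}{\sigma^2}(\sqrt p+2)+1\Big)\Big(1+b\sqrt{\tfrac{p(p+1)}2}\Big)+\sqrt{p+1}\,\Big(1+\sqrt{\tfrac p2}\Big).$$ Let $L_2(p)=\ell C(p)^2+\ell^2C(p)^4/m_c$,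 $L_0=\max_{d\le p\le 2d-1}L_2(p)$, $\lambda_0=1-2\big(\sqrt{1+2L_0/m_f}+1\big)^{-1}$, and $$\lambda=\lambda_0^{1/(2d-1)},\qquad C=\frac{2L_0}{m_f}\,\lambda_0^{-1}.$$ **Theorem.** We have $0<\lambda<1$. For all integers $t\ge0$ and $p\ge d$ with $t+p\le T$, the minimizers $\tilde\psi_t^p(x,\zeta;F)$ and $\psi_t^p(x,\zeta,z)$ exist and are unique for all $x,\zeta,z$, and for all $(x,\zeta,z)$, $(x',\zeta',z')$ and all $0\le h\le p$, $$\|\tilde\psi_t^p(x,\zeta;F)_{y_h}-\tilde\psi_t^p(x',\zeta';F)_{y_h}\|\le C\Big(\lambda^h\|x-x'\|+\sum_{\tau=0}^{p-1}\lambda^{|h-\tau|}\|\zeta_\tau-\zeta'_\tau\|\Big),$$ $$\|\psi_t^p(x,\zeta,z)_{y_h}-\psi_t^p(x',\zeta',z')_{y_h}\|\le C\Big(\lambda^h\|x-x'\|+\sum_{\tau=0}^{p-1}\lambda^{|h-\tau|}\|\zeta_\tau-\zeta'_\tau\|+\lambda^{p-h}\|z-z'\|\Big).$$ -/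

import Mathlib

open scoped Matrix.Norms.L2Operator

noncomputable section

namespace LTV

/-- Euclidean space `ℝⁿ` with the 2-norm. -/
abbrev Vec (n : ℕ) : Type := EuclideanSpace ℝ (Fin n)

/-! ### Convexity and smoothness -/

/-- `g` is `m`-strongly convex (first-order form, for differentiable `g`). -/
def StronglyConvex {n : ℕ} (m : ℝ) (g : Vec n → ℝ) : Prop :=
  ∀ x y : Vec n, g x + inner ℝ (gradient g x) (y - x) + m / 2 * ‖y - x‖ ^ 2 ≤ g y

/-- `g` is `ℓ`-strongly smooth (for differentiable `g`). -/
def StronglySmooth {n : ℕ} (l : ℝ) (g : Vec n → ℝ) : Prop :=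
  ∀ x y : Vec n, g y ≤ g x + inner ℝ (gradient g x) (y - x) + l / 2 * ‖y - x‖ ^ 2

/-- Well-conditioned stage costs: `f t` is the state cost and `c t` the control cost
at time `t = 1, …, T`. -/
structure WellConditioned {n m : ℕ} (T : ℕ) (f : ℕ → Vec n → ℝ) (c : ℕ → Vec m → ℝ)
    (mf lf mc lc : ℝ) : Prop where
  f_convex : ∀ t, 1 ≤ t → t ≤ T → StronglyConvex mf (f t)
  f_smooth : ∀ t, 1 ≤ t → t < T → StronglySmooth lf (f t)
  c_convex : ∀ t, 1 ≤ t → t ≤ T → StronglyConvex mc (c t)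
  c_smooth : ∀ t, 1 ≤ t → t ≤ T → StronglySmooth lc (c t)
  f_contDiff : ∀ t, 1 ≤ t → t ≤ T → ContDiff ℝ 2 (f t)
  c_contDiff : ∀ t, 1 ≤ t → t ≤ T → ContDiff ℝ 2 (c t)
  f_nonneg : ∀ t, 1 ≤ t → t ≤ T → ∀ x, 0 ≤ f t x
  c_nonneg : ∀ t, 1 ≤ t → t ≤ T → ∀ u, 0 ≤ c t u
  f_zero : ∀ t, 1 ≤ t → t ≤ T → f t 0 = 0
  c_zero : ∀ t, 1 ≤ t → t ≤ T → c t 0 = 0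

/-! ### Dynamics and controllability -/

/-- `transAux A t k = A (t+k-1) * ⋯ * A (t+1) * A t`. -/
def transAux {n : ℕ} (A : ℕ → Matrix (Fin n) (Fin n) ℝ) (t : ℕ) :
    ℕ → Matrix (Fin n) (Fin n) ℝ
  | 0 => 1
  | k + 1 => A (t + k) * transAux A t k

/-- The transition matrix `Φ(t₂, t₁) = A (t₂-1) * ⋯ * A t₁` if `t₂ > t₁`, and the identity
otherwise. -/
def transition {n : ℕ} (A : ℕ → Matrix (Fin n) (Fin n) ℝ) (t₂ t₁ : ℕ) :
    Matrix (Fin n) (Fin n) ℝ :=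
  transAux A t₁ (t₂ - t₁)

/-- The controllability matrix
`M(t, p) = [Φ(t+p, t+1) B_t, Φ(t+p, t+2) B_{t+1}, …, Φ(t+p, t+p) B_{t+p-1}]`, an
`n × (mp)` matrix; column `(j, l)` is the `l`-th column of the `j`-th block. -/
def ctrbMatrix {n m : ℕ} (A : ℕ → Matrix (Fin n) (Fin n) ℝ) (B : ℕ → Matrix (Fin n) (Fin m) ℝ)
    (t p : ℕ) : Matrix (Fin n) (Fin p × Fin m) ℝ :=
  Matrix.of fun i jl => (transition A (t + p) (t + jl.1 + 1) * B (t + jl.1)) i jl.2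

/-- The norm bounds on the system matrices and `(d, σ)`-uniform controllability: all `n`
singular values of the `n × (md)` matrix `M(t, d)` are at least `σ`.
(Matrix norms are the operator norms induced by the 2-norms.) -/
structure UniformlyControllable {n m : ℕ} (T : ℕ) (A : ℕ → Matrix (Fin n) (Fin n) ℝ)
    (B : ℕ → Matrix (Fin n) (Fin m) ℝ) (d : ℕ) (a b σ : ℝ) : Prop where
  norm_A_le : ∀ t, t < T → ‖A t‖ ≤ a
  norm_B_le : ∀ t, t < T → ‖B t‖ ≤ b
  sigma_le : ∀ t, t + d ≤ T → ∀ i, i < n →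
    σ ≤ (Matrix.toEuclideanLin (ctrbMatrix A B t d)).singularValues i

/-! ### The two finite-horizon optimal control problems -/

/-- A trajectory of horizon `p`: states `y_0, …, y_p` and controls `v_0, …, v_{p-1}`. -/
abbrev Traj (n m p : ℕ) : Type := (Fin (p + 1) → Vec n) × (Fin p → Vec m)

/-- The trajectories that start at time `t` in state `x` and obey
`y_{τ+1} = A_{t+τ} y_τ + B_{t+τ} v_τ + ζ_τ`. -/
def feasible {n m : ℕ} (A : ℕ → Matrix (Fin n) (Fin n) ℝ) (B : ℕ → Matrix (Fin n) (Fin m) ℝ)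
    (t : ℕ) {p : ℕ} (x : Vec n) (ζ : Fin p → Vec n) : Set (Traj n m p) :=
  {s | s.1 0 = x ∧ ∀ τ : Fin p, s.1 τ.succ =
    Matrix.toEuclideanLin (A (t + τ)) (s.1 τ.castSucc) +
      Matrix.toEuclideanLin (B (t + τ)) (s.2 τ) + ζ τ}

/-- The accumulated stage costs `∑_{τ=1}^p f_{t+τ}(y_τ) + ∑_{τ=1}^p c_{t+τ}(v_{τ-1})`. -/
def stageCost {n m : ℕ} (f : ℕ → Vec n → ℝ) (c : ℕ → Vec m → ℝ) (t : ℕ) {p : ℕ}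
    (s : Traj n m p) : ℝ :=
  ∑ τ : Fin p, f (t + τ + 1) (s.1 τ.succ) + ∑ τ : Fin p, c (t + τ + 1) (s.2 τ)

/-- The indicator function of the origin: `0` at `0` and `+∞` elsewhere. -/
def indicatorZero (n : ℕ) : Vec n → EReal :=
  open Classical in fun x => if x = 0 then 0 else ⊤

/-- `F` is the indicator function of the origin, or a real-valued, non-negative, convex, twice
continuously differentiable function with `F 0 = 0`. -/
def IsTerminalCost {n : ℕ} (F : Vec n → EReal) : Prop :=
  F = indicatorZero n ∨
    ∃ g : Vec n → ℝ, (F = fun x => (g x : EReal)) ∧ (∀ x, 0 ≤ g x) ∧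
      ConvexOn ℝ Set.univ g ∧ ContDiff ℝ 2 g ∧ g 0 = 0

/-- `s` is an optimal solution of the problem with terminal cost `F`. -/
def SolvesCost {n m : ℕ} (A : ℕ → Matrix (Fin n) (Fin n) ℝ) (B : ℕ → Matrix (Fin n) (Fin m) ℝ)
    (f : ℕ → Vec n → ℝ) (c : ℕ → Vec m → ℝ) (F : Vec n → EReal) (t : ℕ) {p : ℕ}
    (x : Vec n) (ζ : Fin p → Vec n) (s : Traj n m p) : Prop :=
  s ∈ feasible A B t x ζ ∧
    IsMinOn (fun r : Traj n m p => (stageCost f c t r : EReal) + F (r.1 (Fin.last p)))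
      (feasible A B t x ζ) s

/-- `s` is an optimal solution of the problem with terminal constraint `y_p = z`. -/
def SolvesTerminal {n m : ℕ} (A : ℕ → Matrix (Fin n) (Fin n) ℝ)
    (B : ℕ → Matrix (Fin n) (Fin m) ℝ) (f : ℕ → Vec n → ℝ) (c : ℕ → Vec m → ℝ) (t : ℕ) {p : ℕ}
    (x : Vec n) (ζ : Fin p → Vec n) (z : Vec n) (s : Traj n m p) : Prop :=
  s ∈ feasible A B t x ζ ∩ {r | r.1 (Fin.last p) = z} ∧
    IsMinOn (stageCost f c t) (feasible A B t x ζ ∩ {r | r.1 (Fin.last p) = z}) s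

/-! ### The explicit constants -/

/-- The constant `C(p)`. -/
def steerConst (a b σ : ℝ) (p : ℕ) : ℝ :=
  open Classical in
  if a = 1 then
    (b * √p / σ ^ 2 * (√p + 2) + 1) * (1 + b * √((p : ℝ) * (p + 1) / 2)) +
      √((p : ℝ) + 1) * (1 + √((p : ℝ) / 2))
  else
    (b * (a ^ (p + 1) + a - 2) / (σ ^ 2 * (a - 1)) * √((a ^ (2 * p) - 1) / (a ^ 2 - 1)) +
        (1 + b) / b) *
      (b * √(a ^ (2 * p + 2) - (p + 1) * a ^ 2 + p) / |a ^ 2 - 1| + 1) +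
      √((a ^ (2 * p + 2) - 1) / (a ^ 2 - 1)) - 1 / b

/-- `L₂(p) = ℓ C(p)² + ℓ² C(p)⁴ / m_c` with `ℓ = max(ℓ_f, ℓ_c)`. -/
def smoothConst (lf mc lc a b σ : ℝ) (p : ℕ) : ℝ :=
  max lf lc * steerConst a b σ p ^ 2 + max lf lc ^ 2 * steerConst a b σ p ^ 4 / mc

/-- `L₀ = max_{d ≤ p ≤ 2d-1} L₂(p)`; the index set is finite, and non-empty for `d ≥ 1`. -/
def L0 (lf mc lc a b σ : ℝ) (d : ℕ) : ℝ :=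
  sSup (smoothConst lf mc lc a b σ '' Set.Icc d (2 * d - 1))

/-- `λ₀ = 1 - 2 (√(1 + 2 L₀ / m_f) + 1)⁻¹`. -/
def rate0 (mf lf mc lc a b σ : ℝ) (d : ℕ) : ℝ :=
  1 - 2 * (√(1 + 2 * L0 lf mc lc a b σ d / mf) + 1)⁻¹

/-- The decay rate `λ = λ₀ ^ (1 / (2d - 1))`. -/
def rate (mf lf mc lc a b σ : ℝ) (d : ℕ) : ℝ :=
  rate0 mf lf mc lc a b σ d ^ (1 / (2 * (d : ℝ) - 1))

/-- The constant `C = (2 L₀ / m_f) λ₀⁻¹`. -/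
def bigC (mf lf mc lc a b σ : ℝ) (d : ℕ) : ℝ :=
  2 * L0 lf mc lc a b σ d / mf * (rate0 mf lf mc lc a b σ d)⁻¹

end LTV

end

/-!
# Exponential decay of perturbations in finite-horizon optimal control

Take two optimal trajectories for different data and write `y`, `v` for the differences of their
states and controls. The differences `g`, `r` of the cost gradients and the costate `p` of the
first-order conditions satisfy the linear system `LTV.Extremal`, in which the costs enter only
through strong convexity and cocoercivity of their gradients (`‖g‖² ≤ ℓ ⟪g, y⟫`, also after
`m / 2 * ‖·‖²` has been subtracted from the cost, with `m = m_f`). The quantity `⟪p, y⟫` decreases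
along undisturbed steps by the dissipation `⟪g, y⟫ + ⟪r, v⟫`.

*Controllability.* The bound on the singular values gives controls of minimal size. Hence any two
states at distance `k ∈ [d, 2d-1]` are joined by a trajectory of size at most `C(k)` times that of
the two states (`LTV.Steerable`), and similarly a single disturbance is absorbed within `d` steps
(`LTV.Absorbing`). Pairing the costate equation with such a trajectory bounds the costates at both
ends of a block by the dissipation in the block (`LTV.Extremal.costate_bound`), with the constant
`L₀ ≥ ℓ C(k)²`.

*Decay.* Over a block these bounds complete squares in the storage function
`S = ⟪p, y⟫ - m / 2 * ‖y‖²`, which gives `S' ≤ λ₀² S` and `-S ≤ λ₀² (-S')`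
(`LTV.storage_contraction`). Here `λ₀` is the small root of `L₀ (1 - λ₀)² = 2 m λ₀`, which is the
rate of the theorem. Once the perturbation lies in the past, `S ≥ m / 2 * ‖y‖²` and the first
inequality yields decay forwards in time; while it lies in the future, `-S ≥ m / 2 * ‖y‖²` and the
second yields decay backwards. Distances below `d`, where no block fits, are covered by the energy
bound `m ‖y‖² ≤ L₀ ‖perturbation‖²`, since then `λ^|h - τ| ≥ √λ₀` and the constant
`C = 4 / (1 - λ₀)²` has enough room. The data are changed one at a time, and the bounds are summed.

Existence of the minimizers follows from coercivity, and uniqueness from vanishing dissipation. The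
terminal constraint enters through a Lagrange multiplier, a terminal cost through its monotone
gradient; the indicator function of the origin is the terminal constraint `y_p = 0`.
-/

open scoped Matrix.Norms.L2Operator

namespace LTV

open Finset

/-! ### Cocoercivity and the optimality system -/

section Abstract

variable {X U : Type*} [NormedAddCommGroup X] [InnerProductSpace ℝ X]
  [NormedAddCommGroup U] [InnerProductSpace ℝ U]

/-- A function that lies above its tangents and at most `l / 2 * ‖y - x‖ ^ 2` above them has a
cocoercive gradient. The map `G` plays the role of the gradient. -/
theorem cocoercive_of_convex_of_smooth {h : X → ℝ} {G : X → X} {l : ℝ} (hl : 0 < l)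
    (hconv : ∀ x y, h x + inner ℝ (G x) (y - x) ≤ h y)
    (hsm : ∀ x y, h y ≤ h x + inner ℝ (G x) (y - x) + l / 2 * ‖y - x‖ ^ 2) (x y : X) :
    ‖G x - G y‖ ^ 2 ≤ l * inner ℝ (G x - G y) (x - y) := by
  have key : ∀ x y : X,
      ‖G x - G y‖ ^ 2 ≤ 2 * l * (h y - h x - inner ℝ (G x) (y - x)) := by
    intro x y
    -- the minimizer of the quadratic upper bound at `y` for `h` minus its tangent at `x`
    have h1 := hconv x (y - l⁻¹ • (G y - G x))
    have h2 := hsm y (y - l⁻¹ • (G y - G x))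
    have e1 : inner ℝ (G x) (y - l⁻¹ • (G y - G x) - x)
        = inner ℝ (G x) (y - x) - l⁻¹ * inner ℝ (G x) (G y - G x) := by
      rw [show y - l⁻¹ • (G y - G x) - x = (y - x) - l⁻¹ • (G y - G x) by abel,
        inner_sub_right, real_inner_smul_right]
    have e2 : y - l⁻¹ • (G y - G x) - y = -(l⁻¹ • (G y - G x)) := by abel
    have e3 : inner ℝ (G y) (G y - G x) - inner ℝ (G x) (G y - G x) = ‖G x - G y‖ ^ 2 := by
      rw [← inner_sub_left, real_inner_self_eq_norm_sq, norm_sub_rev]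
    rw [e1] at h1
    rw [e2, inner_neg_right, real_inner_smul_right, norm_neg, norm_smul, mul_pow, norm_inv,
      Real.norm_of_nonneg hl.le, norm_sub_rev (G y)] at h2
    have e4 : l / 2 * (l⁻¹ ^ 2 * ‖G x - G y‖ ^ 2) = l⁻¹ * ‖G x - G y‖ ^ 2 / 2 := by
      field_simp
    rw [e4] at h2
    have e5 : l⁻¹ * ‖G x - G y‖ ^ 2 ≤ 2 * (h y - h x - inner ℝ (G x) (y - x)) := by
      rw [← e3] at h2 ⊢
      linarith
    calc ‖G x - G y‖ ^ 2 = l * (l⁻¹ * ‖G x - G y‖ ^ 2) := by field_simp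
      _ ≤ l * (2 * (h y - h x - inner ℝ (G x) (y - x))) := by gcongr
      _ = _ := by ring
  have h1 := key x y
  have h2 := key y x
  rw [norm_sub_rev] at h2
  have e : inner ℝ (G x - G y) (x - y) = -inner ℝ (G x) (y - x) - inner ℝ (G y) (x - y) := by
    rw [inner_sub_left, ← inner_neg_right, neg_sub]
  rw [e]
  linarith

/-- Cauchy–Schwarz for paired sequences, with the squared norms of one side dominated by
`l * δ j`. -/
theorem sq_sum_inner_le {k : ℕ} {l : ℝ} {g w : ℕ → X} {r u : ℕ → U} {δ : ℕ → ℝ}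
    (h : ∀ j < k, ‖g j‖ ^ 2 + ‖r j‖ ^ 2 ≤ l * δ j) :
    (∑ j ∈ range k, (inner ℝ (g j) (w j) + inner ℝ (r j) (u j))) ^ 2 ≤
      (∑ j ∈ range k, δ j) * (l * ∑ j ∈ range k, (‖w j‖ ^ 2 + ‖u j‖ ^ 2)) := by
  have h0 : ∀ j ∈ range k, (inner ℝ (g j) (w j) + inner ℝ (r j) (u j)) ^ 2 ≤
      (‖g j‖ ^ 2 + ‖r j‖ ^ 2) * (‖w j‖ ^ 2 + ‖u j‖ ^ 2) := by
    intro j _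
    have h1 := abs_real_inner_le_norm (g j) (w j)
    have h2 := abs_real_inner_le_norm (r j) (u j)
    have h3 : |inner ℝ (g j) (w j) + inner ℝ (r j) (u j)| ≤ ‖g j‖ * ‖w j‖ + ‖r j‖ * ‖u j‖ :=
      (abs_add_le _ _).trans (add_le_add h1 h2)
    rw [← sq_abs]
    calc _ ≤ (‖g j‖ * ‖w j‖ + ‖r j‖ * ‖u j‖) ^ 2 := by gcongr
      _ ≤ _ := by nlinarith [sq_nonneg (‖g j‖ * ‖u j‖ - ‖r j‖ * ‖w j‖)]
  calc _ ≤ (∑ j ∈ range k, (‖g j‖ ^ 2 + ‖r j‖ ^ 2)) * ∑ j ∈ range k, (‖w j‖ ^ 2 + ‖u j‖ ^ 2) :=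
        sum_sq_le_sum_mul_sum_of_sq_le_mul _ (fun j _ => by positivity) (fun j _ => by positivity) h0
    _ ≤ (∑ j ∈ range k, l * δ j) * ∑ j ∈ range k, (‖w j‖ ^ 2 + ‖u j‖ ^ 2) := by
        gcongr with j hj
        exact h j (mem_range.1 hj)
    _ = _ := by rw [← mul_sum]; ring

/-- The states `w` and controls `u`, indexed relative to the starting time `i`, follow for `k`
steps the dynamics `(𝒜, ℬ)` with disturbance `e`. -/
def Evolves (𝒜 : ℕ → X →ₗ[ℝ] X) (ℬ : ℕ → U →ₗ[ℝ] X) (i k : ℕ) (w : ℕ → X) (u : ℕ → U)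
    (e : ℕ → X) : Prop :=
  ∀ j < k, w (j + 1) = 𝒜 (i + j) (w j) + ℬ (i + j) (u j) + e j

/-- Any two states at distance `k ∈ [d, 2d-1]` are joined by an undisturbed trajectory whose
squared size is at most `L / l` times that of its two end points. -/
def Steerable (𝒜 : ℕ → X →ₗ[ℝ] X) (ℬ : ℕ → U →ₗ[ℝ] X) (N d : ℕ) (l L : ℝ) : Prop :=
  ∀ i k, d ≤ k → k ≤ 2 * d - 1 → i + k ≤ N → ∀ x z, ∃ w u, Evolves 𝒜 ℬ i k w u 0 ∧
    w 0 = x ∧ w k = z ∧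
    l * ∑ j ∈ range k, (‖w j‖ ^ 2 + ‖u j‖ ^ 2) ≤ L * (‖x‖ ^ 2 + ‖z‖ ^ 2)

/-- A single disturbance inside a window of length `d` can be absorbed by a trajectory that
vanishes at both ends of the window, of squared size at most `L / l` times that of the
disturbance. -/
def Absorbing (𝒜 : ℕ → X →ₗ[ℝ] X) (ℬ : ℕ → U →ₗ[ℝ] X) (N d : ℕ) (l L : ℝ) : Prop :=
  ∀ i s, s < d → i + d ≤ N → ∀ e : X, ∃ w u, Evolves 𝒜 ℬ i d w u (Pi.single s e) ∧
    w 0 = 0 ∧ w d = 0 ∧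
    l * ∑ j ∈ range d, (‖w j‖ ^ 2 + ‖u j‖ ^ 2) ≤ L * ‖e‖ ^ 2

/-- The optimality system satisfied by the difference of two optimal trajectories on `[0, N]`:
`y`, `v`, `ζ` are the differences of the states, controls and disturbances, `g`, `r` those of the
cost gradients, and `p` is the difference of the costates. The initial state carries no cost; the
convention `g 0 = m • y 0` gives it the cost `m / 2 * ‖y 0‖ ^ 2`. Nothing is said about the costate
at the final time `N`, which depends on the terminal condition. -/
structure Extremal (𝒜 : ℕ → X →ₗ[ℝ] X) (ℬ : ℕ → U →ₗ[ℝ] X) (N : ℕ) (m l : ℝ)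
    (y : ℕ → X) (v : ℕ → U) (ζ p g : ℕ → X) (r : ℕ → U) : Prop where
  dynamics : Evolves 𝒜 ℬ 0 N y v ζ
  costate : ∀ j < N, ∀ w, inner ℝ (p j) w = inner ℝ (g j) w + inner ℝ (p (j + 1)) (𝒜 j w)
  control : ∀ j < N, ∀ u, inner ℝ (r j) u + inner ℝ (p (j + 1)) (ℬ j u) = 0
  g_zero : g 0 = m • y 0
  cocoercive_g : ∀ j, 0 < j → j < N → ‖g j‖ ^ 2 ≤ l * inner ℝ (g j) (y j)
  cocoercive_g_sub : ∀ j < N, ‖g j - m • y j‖ ^ 2 ≤ l * inner ℝ (g j - m • y j) (y j)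
  cocoercive_r : ∀ j < N, ‖r j‖ ^ 2 ≤ l * inner ℝ (r j) (v j)

/-- The pairing of gradient differences with state and control differences at one time. -/
noncomputable def dissipation (y : ℕ → X) (v : ℕ → U) (g : ℕ → X) (r : ℕ → U) (j : ℕ) : ℝ :=
  inner ℝ (g j) (y j) + inner ℝ (r j) (v j)

namespace Extremal

variable {𝒜 : ℕ → X →ₗ[ℝ] X} {ℬ : ℕ → U →ₗ[ℝ] X} {N d : ℕ} {m l L μ lam C : ℝ}
  {y : ℕ → X} {v : ℕ → U} {ζ p g : ℕ → X} {r : ℕ → U}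

theorem evolves (H : Extremal 𝒜 ℬ N m l y v ζ p g r) {i k : ℕ} (hik : i + k ≤ N) :
    Evolves 𝒜 ℬ i k (fun j => y (i + j)) (fun j => v (i + j)) (fun j => ζ (i + j)) := by
  intro j hj
  simpa [add_assoc] using H.dynamics (i + j) (by omega)

/-- Summation by parts of the costate equation along an arbitrary trajectory. -/
theorem pairing (H : Extremal 𝒜 ℬ N m l y v ζ p g r) {i k : ℕ} (hik : i + k ≤ N)
    {w : ℕ → X} {u : ℕ → U} {e : ℕ → X} (hw : Evolves 𝒜 ℬ i k w u e) :
    inner ℝ (p i) (w 0) + ∑ j ∈ range k, inner ℝ (p (i + j + 1)) (e j) =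
      inner ℝ (p (i + k)) (w k) +
        ∑ j ∈ range k, (inner ℝ (g (i + j)) (w j) + inner ℝ (r (i + j)) (u j)) := by
  induction k with
  | zero => simp
  | succ k ih =>
    have h1 := ih (by omega) (fun j hj => hw j (by omega))
    have h2 := H.costate (i + k) (by omega) (w k)
    have h3 := H.control (i + k) (by omega) (u k)
    have h4 := hw k (by omega)
    rw [sum_range_succ, sum_range_succ, ← add_assoc, h1, h2, ← add_assoc i k 1, h4,
      inner_add_right, inner_add_right]
    linarith

theorem energy (H : Extremal 𝒜 ℬ N m l y v ζ p g r) {i k : ℕ} (hik : i + k ≤ N) :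
    inner ℝ (p i) (y i) + ∑ j ∈ range k, inner ℝ (p (i + j + 1)) (ζ (i + j)) =
      inner ℝ (p (i + k)) (y (i + k)) + ∑ j ∈ range k, dissipation y v g r (i + j) :=
  H.pairing hik (H.evolves hik)

theorem inner_r_nonneg (H : Extremal 𝒜 ℬ N m l y v ζ p g r) (hl : 0 < l) {j : ℕ} (hj : j < N) :
    0 ≤ inner ℝ (r j) (v j) :=
  nonneg_of_mul_nonneg_right ((sq_nonneg _).trans (H.cocoercive_r j hj)) hl

theorem norm_sq_le_dissipation (H : Extremal 𝒜 ℬ N m l y v ζ p g r) (hl : 0 < l) {j : ℕ}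
    (hj : j < N) : m * ‖y j‖ ^ 2 ≤ dissipation y v g r j := by
  have h := nonneg_of_mul_nonneg_right ((sq_nonneg _).trans (H.cocoercive_g_sub j hj)) hl
  rw [inner_sub_left, real_inner_smul_left, real_inner_self_eq_norm_sq] at h
  have := H.inner_r_nonneg hl hj
  unfold dissipation
  linarith

theorem dissipation_nonneg (H : Extremal 𝒜 ℬ N m l y v ζ p g r) (hl : 0 < l) (hm : 0 < m)
    {j : ℕ} (hj : j < N) : 0 ≤ dissipation y v g r j :=
  le_trans (by positivity) (H.norm_sq_le_dissipation hl hj)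

theorem sum_dissipation_nonneg (H : Extremal 𝒜 ℬ N m l y v ζ p g r) (hl : 0 < l) (hm : 0 < m)
    {i k : ℕ} (hik : i + k ≤ N) : 0 ≤ ∑ j ∈ range k, dissipation y v g r (i + j) :=
  sum_nonneg fun j hj => H.dissipation_nonneg hl hm (by have := mem_range.1 hj; omega)

theorem sum_dissipation_le (H : Extremal 𝒜 ℬ N m l y v ζ p g r) (hl : 0 < l) (hm : 0 < m)
    {i k : ℕ} (hik : i + k ≤ N) :
    ∑ j ∈ range k, dissipation y v g r (i + j) ≤ ∑ j ∈ range N, dissipation y v g r j := by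
  rw [range_eq_Ico, sum_Ico_add (fun j => dissipation y v g r j) 0 k i]
  refine sum_le_sum_of_subset_of_nonneg ?_ fun j hj _ =>
    H.dissipation_nonneg hl hm (mem_range.1 hj)
  intro j hj
  simp only [mem_Ico, mem_range] at *
  omega

theorem norm_sq_le_sum_dissipation (H : Extremal 𝒜 ℬ N m l y v ζ p g r) (hl : 0 < l) (hm : 0 < m)
    {i k j : ℕ} (hik : i + k ≤ N) (hj : j < k) :
    m * ‖y (i + j)‖ ^ 2 ≤ ∑ j ∈ range k, dissipation y v g r (i + j) :=
  (H.norm_sq_le_dissipation hl (by omega)).trans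
    (single_le_sum (f := fun j => dissipation y v g r (i + j))
      (fun j hj => H.dissipation_nonneg hl hm (by have := mem_range.1 hj; omega))
      (mem_range.2 hj))

/-- The costates at both ends of a window are controlled by the dissipation inside: pair the
costate equation with a trajectory that steers between the end costates. The quadratic cost
`m / 2 * ‖y i‖ ^ 2` is split off at the left end. -/
theorem costate_bound (H : Extremal 𝒜 ℬ N m l y v ζ p g r) (hl : 0 < l) (hm : 0 < m)
    (hL : 0 < L) (hd : 1 ≤ d) (hst : Steerable 𝒜 ℬ N d l L) {i k : ℕ} (hdk : d ≤ k)
    (hk : k ≤ 2 * d - 1) (hik : i + k ≤ N) :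
    ‖p i - m • y i‖ ^ 2 + ‖p (i + k)‖ ^ 2 ≤
      L * (∑ j ∈ range k, dissipation y v g r (i + j) - m * ‖y i‖ ^ 2) := by
  obtain ⟨w, u, hw, h0, hk', hb⟩ := hst i k hdk hk hik (p i - m • y i) (-p (i + k))
  obtain ⟨k, rfl⟩ : ∃ k', k = k' + 1 := ⟨k - 1, by omega⟩
  have hp := H.pairing hik hw
  rw [norm_neg] at hb
  set Q := ‖p i - m • y i‖ ^ 2 + ‖p (i + (k + 1))‖ ^ 2 with hQ
  set D := ∑ j ∈ range (k + 1), dissipation y v g r (i + j) - m * ‖y i‖ ^ 2 with hD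
  let gt : ℕ → X := fun j => if j = 0 then g i - m • y i else g (i + j)
  let δ : ℕ → ℝ := fun j => dissipation y v g r (i + j) - if j = 0 then m * ‖y i‖ ^ 2 else 0
  have hδ : ∑ j ∈ range (k + 1), δ j = D := by
    simp [δ, hD, sum_sub_distrib]
  have hQe : Q = ∑ j ∈ range (k + 1), (inner ℝ (gt j) (w j) + inner ℝ (r (i + j)) (u j)) := by
    have e1 : ∑ j ∈ range (k + 1), (inner ℝ (gt j) (w j) + inner ℝ (r (i + j)) (u j)) =
        ∑ j ∈ range (k + 1), (inner ℝ (g (i + j)) (w j) + inner ℝ (r (i + j)) (u j))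
          - m * inner ℝ (y i) (w 0) := by
      rw [sum_range_succ', sum_range_succ' (fun j => inner ℝ (g (i + j)) (w j) + _)]
      simp [gt, inner_sub_left, real_inner_smul_left]
      ring
    rw [e1]
    rw [h0, hk'] at hp
    rw [h0]
    simp only [Pi.zero_apply, inner_zero_right, sum_const_zero, add_zero, inner_neg_right,
      real_inner_self_eq_norm_sq] at hp
    have e2 : inner ℝ (p i) (p i - m • y i) - m * inner ℝ (y i) (p i - m • y i) =
        ‖p i - m • y i‖ ^ 2 := by
      rw [← real_inner_smul_left, ← inner_sub_left, real_inner_self_eq_norm_sq]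
    linarith
  have hcs := sq_sum_inner_le (k := k + 1) (l := l) (g := gt) (w := w)
    (r := fun j => r (i + j)) (u := u) (δ := δ) (by
      intro j hj
      have hr := H.cocoercive_r (i + j) (by omega)
      by_cases h : j = 0
      · subst h
        have := H.cocoercive_g_sub i (by omega)
        rw [inner_sub_left, real_inner_smul_left, real_inner_self_eq_norm_sq] at this
        simp only [gt, δ, if_true, dissipation, add_zero] at hr ⊢
        linarith
      · have := H.cocoercive_g (i + j) (by omega) (by omega)
        simp only [gt, δ, if_neg h, dissipation] at *
        linarith)
  rw [← hQe, hδ] at hcs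
  have hD0 : 0 ≤ D := by
    have := H.norm_sq_le_sum_dissipation hl hm hik (Nat.succ_pos k)
    simp only [add_zero] at this
    linarith
  have h2 : Q ^ 2 ≤ D * (L * Q) := hcs.trans (by gcongr)
  have hQ0 : 0 ≤ Q := by positivity
  rcases hQ0.eq_or_lt with h | h
  · rw [← h]; positivity
  · nlinarith

/-- The costate right after a disturbance inside a window is controlled by the dissipation in the
window: pair the costate equation with a trajectory that absorbs the disturbance. -/
theorem costate_bound_inside (H : Extremal 𝒜 ℬ N m l y v ζ p g r) (hl : 0 < l) (hm : 0 < m)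
    (hL : 0 < L) (hab : Absorbing 𝒜 ℬ N d l L) {i s : ℕ} (hs : s < d) (hik : i + d ≤ N) :
    ‖p (i + s + 1)‖ ^ 2 ≤ L * ∑ j ∈ range d, dissipation y v g r (i + j) := by
  obtain ⟨w, u, hw, h0, hk', hb⟩ := hab i s hs hik (p (i + s + 1))
  have hp := H.pairing hik hw
  have e1 : ∑ j ∈ range d, inner ℝ (p (i + j + 1)) (Pi.single (M := fun _ => X) s (p (i + s + 1)) j)
      = ‖p (i + s + 1)‖ ^ 2 := by
    rw [sum_eq_single s]
    · simp
    · intro j _ hj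
      simp [Pi.single_eq_of_ne hj]
    · intro h
      simp [hs] at h
  rw [h0, hk', e1] at hp
  simp only [inner_zero_right, zero_add] at hp
  set Q := ‖p (i + s + 1)‖ ^ 2 with hQ
  set D := ∑ j ∈ range d, dissipation y v g r (i + j) with hD
  -- the start of the window is paired with `w 0 = 0`, so its gradient may be replaced by zero
  let gt : ℕ → X := fun j => if j = 0 then 0 else g (i + j)
  have hQe : Q = ∑ j ∈ range d, (inner ℝ (gt j) (w j) + inner ℝ (r (i + j)) (u j)) := by
    rw [hp]
    refine sum_congr rfl fun j _ => ?_
    by_cases h : j = 0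
    · simp [gt, h, h0]
    · simp [gt, h]
  have hcs := sq_sum_inner_le (k := d) (l := l) (g := gt) (w := w)
    (r := fun j => r (i + j)) (u := u) (δ := fun j => dissipation y v g r (i + j)) (by
      intro j hj
      have hr := H.cocoercive_r (i + j) (by omega)
      by_cases h : j = 0
      · subst h
        have := nonneg_of_mul_nonneg_right
          ((sq_nonneg _).trans (H.cocoercive_g_sub i (by omega))) hl
        rw [inner_sub_left, real_inner_smul_left, real_inner_self_eq_norm_sq] at this
        have h3 : 0 ≤ inner ℝ (g i) (y i) := by
          have : 0 ≤ m * ‖y i‖ ^ 2 := by positivity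
          linarith
        simp only [gt, if_true, dissipation, add_zero, norm_zero] at hr ⊢
        nlinarith
      · have := H.cocoercive_g (i + j) (by omega) (by omega)
        simp only [gt, if_neg h, dissipation] at *
        linarith)
  rw [← hQe, ← hD] at hcs
  have hD0 : 0 ≤ D := H.sum_dissipation_nonneg hl hm hik
  have h2 : Q ^ 2 ≤ D * (L * Q) := hcs.trans (by gcongr)
  have hQ0 : 0 ≤ Q := by positivity
  rcases hQ0.eq_or_lt with h | h
  · rw [← h]; positivity
  · nlinarith

end Extremal

end Abstract

/-! ### Decay along the optimality system -/

section Abstract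

variable {X U : Type*} [NormedAddCommGroup X] [InnerProductSpace ℝ X]
  [NormedAddCommGroup U] [InnerProductSpace ℝ U]

/-- The storage function `⟪p, z⟫ - m / 2 * ‖z‖ ^ 2` contracts by the factor `ν ^ 2` over a block
that dissipates enough. The hypothesis on `ν` is invariant under `ν ↦ ν⁻¹`, so the inequality holds
for both roots; this gives decay forwards and backwards in time. -/
theorem storage_contraction {m L ν : ℝ} (hν : 0 < ν) (hL : 0 < L)
    (hm : L * (1 - ν) ^ 2 = 2 * ν * m) {p z p' z' : X}
    (h : ‖p - m • z‖ ^ 2 + ‖p'‖ ^ 2 ≤ L * (inner ℝ p z - m * ‖z‖ ^ 2 - inner ℝ p' z')) :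
    inner ℝ p' z' - m / 2 * ‖z'‖ ^ 2 ≤ ν ^ 2 * (inner ℝ p z - m / 2 * ‖z‖ ^ 2) := by
  -- `c` makes both blocks perfect squares
  obtain ⟨c, hc⟩ : ∃ c, 2 * ν * c = L * (1 - ν) := ⟨L * (1 - ν) / (2 * ν), by field_simp⟩
  have hmc : m = (1 - ν) * c := by
    have : 2 * ν * m = 2 * ν * ((1 - ν) * c) := by rw [← hm]; linear_combination (-(1 - ν)) * hc
    exact mul_left_cancel₀ (by positivity) this
  have e : ∀ (c : ℝ) (p z : X), ‖p - c • z‖ ^ 2 = ‖p‖ ^ 2 - 2 * c * inner ℝ p z + c ^ 2 * ‖z‖ ^ 2 := by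
    intro c p z
    rw [norm_sub_sq_real, real_inner_smul_right, norm_smul, mul_pow, Real.norm_eq_abs, sq_abs]
    ring
  have h1 := sq_nonneg ‖p - c • z‖
  have h2 := sq_nonneg ‖p' - c • z'‖
  rw [e] at h h1 h2
  have h3 : 0 ≤ L * (inner ℝ p z - m * ‖z‖ ^ 2 - inner ℝ p' z') -
      (‖p‖ ^ 2 - 2 * m * inner ℝ p z + m ^ 2 * ‖z‖ ^ 2 + ‖p'‖ ^ 2) +
      (‖p‖ ^ 2 - 2 * c * inner ℝ p z + c ^ 2 * ‖z‖ ^ 2) +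
      (‖p'‖ ^ 2 - 2 * c * inner ℝ p' z' + c ^ 2 * ‖z'‖ ^ 2) := by linarith
  have h4 : L * (ν ^ 2 * (inner ℝ p z - m / 2 * ‖z‖ ^ 2) -
      (inner ℝ p' z' - m / 2 * ‖z'‖ ^ 2)) = ν * (L * (inner ℝ p z - m * ‖z‖ ^ 2 - inner ℝ p' z') -
      (‖p‖ ^ 2 - 2 * m * inner ℝ p z + m ^ 2 * ‖z‖ ^ 2 + ‖p'‖ ^ 2) +
      (‖p‖ ^ 2 - 2 * c * inner ℝ p z + c ^ 2 * ‖z‖ ^ 2) +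
      (‖p'‖ ^ 2 - 2 * c * inner ℝ p' z' + c ^ 2 * ‖z'‖ ^ 2)) := by
    generalize inner ℝ p z = s
    generalize inner ℝ p' z' = s'
    generalize ‖z‖ ^ 2 = a
    generalize ‖z'‖ ^ 2 = b
    subst hmc
    linear_combination (ν * s + s' - a * c * ν * (2 - ν) / 2 - b * c / 2) * hc
  have h5 : 0 ≤ L * (ν ^ 2 * (inner ℝ p z - m / 2 * ‖z‖ ^ 2) -
      (inner ℝ p' z' - m / 2 * ‖z'‖ ^ 2)) := h4 ▸ mul_nonneg hν.le h3
  have := nonneg_of_mul_nonneg_right h5 hL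
  linarith

/-- The relations between the cost curvature `m`, the steering constant `L`, the horizon `d` of
controllability, the contraction factor `μ` per block, the decay rate `lam` per step and the
constant `C` of the perturbation bounds. -/
structure Rates (d : ℕ) (m L μ lam C : ℝ) : Prop where
  d_pos : 1 ≤ d
  m_pos : 0 < m
  L_pos : 0 < L
  μ_pos : 0 < μ
  μ_lt_one : μ < 1
  curvature : L * (1 - μ) ^ 2 = 2 * μ * m
  lam_pos : 0 < lam
  lam_le_one : lam ≤ 1
  lam_pow : lam ^ (2 * d - 1) = μ
  C_pos : 0 < C
  C_eq : C * (1 - μ) ^ 2 = 4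

namespace Rates

variable {d : ℕ} {m L μ lam C : ℝ}

theorem C_mul_μ (R : Rates d m L μ lam C) : C * μ * m = 2 * L := by
  have h1 := R.curvature
  have h2 := R.C_eq
  have : (1 - μ) ^ 2 ≠ 0 := by have := R.μ_lt_one; positivity [sub_pos.2 this]
  apply mul_left_cancel₀ this
  linear_combination μ * m * h2 - 2 * h1

theorem four_le_C (R : Rates d m L μ lam C) : 4 ≤ C := by
  have h2 := R.C_eq
  have h3 : (1 - μ) ^ 2 ≤ 1 := by nlinarith [R.μ_pos, R.μ_lt_one]
  nlinarith [R.C_pos]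

/-- Within a distance less than `d` the decay factor is at least `√μ`, so that the energy bound
`m * ‖y‖ ^ 2 ≤ L * ‖x‖ ^ 2` is already as good as the decay estimate. -/
theorem le_of_energy (R : Rates d m L μ lam C) {l : ℕ} (hl : l < d) {a b : ℝ} (hb : 0 ≤ b)
    (h : m * a ^ 2 ≤ L * b ^ 2) : a ≤ C * (lam ^ l * b) := by
  have h1 : μ ≤ (lam ^ l) ^ 2 := by
    rw [← pow_mul, ← R.lam_pow]
    exact pow_le_pow_of_le_one R.lam_pos.le R.lam_le_one (by omega)
  have hlam := R.lam_pos
  have hC := R.C_pos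
  refine le_of_sq_le_sq ?_ (by positivity)
  refine le_of_mul_le_mul_left (h.trans ?_) R.m_pos
  have h2 : L ≤ m * (C ^ 2 * μ) := by
    have := R.C_mul_μ
    nlinarith [R.four_le_C, R.L_pos]
  have hm := R.m_pos
  calc L * b ^ 2 ≤ m * (C ^ 2 * μ) * b ^ 2 := by gcongr
    _ ≤ m * (C ^ 2 * (lam ^ l) ^ 2) * b ^ 2 := by gcongr
    _ = _ := by ring

/-- Passage from a squared bound with decay to the final form. -/
theorem le_of_storage (R : Rates d m L μ lam C) {l : ℕ} {a b K : ℝ} (hb : 0 ≤ b)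
    (hK : 2 * K ≤ m * C ^ 2) (h : m / 2 * a ^ 2 ≤ (lam ^ l) ^ 2 * (K * b ^ 2)) :
    a ≤ C * (lam ^ l * b) := by
  have hlam := R.lam_pos
  have hC := R.C_pos
  refine le_of_sq_le_sq ?_ (by positivity)
  refine le_of_mul_le_mul_left ?_ R.m_pos
  have : (lam ^ l) ^ 2 * b ^ 2 * (2 * K) ≤ (lam ^ l) ^ 2 * b ^ 2 * (m * C ^ 2) := by gcongr
  linarith

end Rates

/-- The storage function along the difference of two optimal trajectories. -/
noncomputable def storage (m : ℝ) (y p : ℕ → X) (j : ℕ) : ℝ :=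
  inner ℝ (p j) (y j) - m / 2 * ‖y j‖ ^ 2

namespace Extremal

variable {𝒜 : ℕ → X →ₗ[ℝ] X} {ℬ : ℕ → U →ₗ[ℝ] X} {N d : ℕ} {m l L μ lam C : ℝ}
  {y : ℕ → X} {v : ℕ → U} {ζ p g : ℕ → X} {r : ℕ → U}

theorem energy_of_undisturbed (H : Extremal 𝒜 ℬ N m l y v ζ p g r) {i k : ℕ} (hik : i + k ≤ N)
    (hζ : ∀ j < k, ζ (i + j) = 0) :
    inner ℝ (p i) (y i) =
      inner ℝ (p (i + k)) (y (i + k)) + ∑ j ∈ range k, dissipation y v g r (i + j) := by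
  rw [← H.energy hik, sum_eq_zero, add_zero]
  intro j hj
  rw [hζ j (mem_range.1 hj), inner_zero_right]

/-- One undisturbed block contracts the storage function in both time directions. -/
theorem storage_block (H : Extremal 𝒜 ℬ N m l y v ζ p g r) (R : Rates d m L μ lam C) (hl : 0 < l)
    (hst : Steerable 𝒜 ℬ N d l L) {i k : ℕ} (hdk : d ≤ k) (hk : k ≤ 2 * d - 1) (hik : i + k ≤ N)
    (hζ : ∀ j < k, ζ (i + j) = 0) :
    storage m y p (i + k) ≤ μ ^ 2 * storage m y p i ∧
      -storage m y p i ≤ μ ^ 2 * -storage m y p (i + k) := by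
  have h := H.costate_bound hl R.m_pos R.L_pos R.d_pos hst hdk hk hik
  have he := H.energy_of_undisturbed hik hζ
  have h' : ‖p i - m • y i‖ ^ 2 + ‖p (i + k)‖ ^ 2 ≤
      L * (inner ℝ (p i) (y i) - m * ‖y i‖ ^ 2 - inner ℝ (p (i + k)) (y (i + k))) := by
    refine h.trans_eq ?_
    rw [he]
    ring
  have hμ := R.μ_pos
  refine ⟨storage_contraction hμ R.L_pos R.curvature h', ?_⟩
  have h2 := storage_contraction (inv_pos.2 hμ) R.L_pos (by
    have := R.curvature
    field_simp
    linear_combination this) h'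
  unfold storage
  rw [inv_pow, ← div_eq_inv_mul, le_div_iff₀ (by positivity)] at h2
  linarith

theorem storage_decay_forward (H : Extremal 𝒜 ℬ N m l y v ζ p g r) (R : Rates d m L μ lam C)
    (hl : 0 < l) (hst : Steerable 𝒜 ℬ N d l L) {k : ℕ} : ∀ {i : ℕ}, d ≤ k → i + k ≤ N →
    (∀ j < k, ζ (i + j) = 0) → (∀ j ≤ k, 0 ≤ storage m y p (i + j)) →
    storage m y p (i + k) ≤ (lam ^ k) ^ 2 * storage m y p i := by
  induction k using Nat.strong_induction_on with
  | _ k ih =>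
    intro i hdk hik hζ hS
    have hd := R.d_pos
    have one : ∀ k', d ≤ k' → k' ≤ 2 * d - 1 → k' ≤ k →
        storage m y p (i + k') ≤ (lam ^ k') ^ 2 * storage m y p i := by
      intro k' h1 h2 h3
      refine (H.storage_block R hl hst h1 h2 (by omega) fun j hj => hζ j (by omega)).1.trans ?_
      have h0 := hS 0 (by omega)
      have hlam := R.lam_pos
      rw [← R.lam_pow]
      have : lam ^ (2 * d - 1) ≤ lam ^ k' :=
        pow_le_pow_of_le_one R.lam_pos.le R.lam_le_one h2
      rw [add_zero] at h0
      gcongr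
    rcases le_or_gt k (2 * d - 1) with h | h
    · exact one k hdk h le_rfl
    · obtain ⟨k, rfl⟩ : ∃ k', k = d + k' := ⟨k - d, by omega⟩
      have h1 := one d le_rfl (by omega) (by omega)
      have h2 := ih k (by omega) (i := i + d) (by omega) (by omega)
        (fun j hj => by rw [add_assoc]; exact hζ _ (by omega))
        (fun j hj => by rw [add_assoc]; exact hS _ (by omega))
      rw [← add_assoc]
      refine h2.trans ?_
      have := mul_le_mul_of_nonneg_left h1 (sq_nonneg (lam ^ k))
      refine this.trans_eq ?_
      rw [pow_add]
      ring

theorem storage_decay_backward (H : Extremal 𝒜 ℬ N m l y v ζ p g r) (R : Rates d m L μ lam C)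
    (hl : 0 < l) (hst : Steerable 𝒜 ℬ N d l L) {k : ℕ} : ∀ {i : ℕ}, d ≤ k → i + k ≤ N →
    (∀ j < k, ζ (i + j) = 0) → (∀ j ≤ k, storage m y p (i + j) ≤ 0) →
    -storage m y p i ≤ (lam ^ k) ^ 2 * -storage m y p (i + k) := by
  induction k using Nat.strong_induction_on with
  | _ k ih =>
    intro i hdk hik hζ hS
    have hd := R.d_pos
    have one : ∀ k', d ≤ k' → k' ≤ 2 * d - 1 → k' ≤ k →
        -storage m y p i ≤ (lam ^ k') ^ 2 * -storage m y p (i + k') := by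
      intro k' h1 h2 h3
      refine (H.storage_block R hl hst h1 h2 (by omega) fun j hj => hζ j (by omega)).2.trans ?_
      have h0 := neg_nonneg.2 (hS k' (by omega))
      have hlam := R.lam_pos
      rw [← R.lam_pow]
      have : lam ^ (2 * d - 1) ≤ lam ^ k' :=
        pow_le_pow_of_le_one R.lam_pos.le R.lam_le_one h2
      gcongr
    rcases le_or_gt k (2 * d - 1) with h | h
    · exact one k hdk h le_rfl
    · obtain ⟨k, rfl⟩ : ∃ k', k = d + k' := ⟨k - d, by omega⟩
      have h1 := one d le_rfl (by omega) (by omega)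
      have h2 := ih k (by omega) (i := i + d) (by omega) (by omega)
        (fun j hj => by rw [add_assoc]; exact hζ _ (by omega))
        (fun j hj => by rw [add_assoc]; exact hS _ (by omega))
      rw [← add_assoc]
      refine h1.trans ?_
      have := mul_le_mul_of_nonneg_left h2 (sq_nonneg (lam ^ d))
      refine this.trans_eq ?_
      rw [pow_add]
      ring

/-- If the rest of the horizon is undisturbed and the terminal condition is dissipative, then the
pairing of costate and state dominates the cost of the present state. -/
theorem norm_sq_le_inner_of_undisturbed_after (H : Extremal 𝒜 ℬ N m l y v ζ p g r) (hl : 0 < l)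
    (hm : 0 < m) (hT : m * ‖y N‖ ^ 2 ≤ inner ℝ (p N) (y N)) {i : ℕ} (hi : i ≤ N)
    (hζ : ∀ j, i ≤ j → j < N → ζ j = 0) : m * ‖y i‖ ^ 2 ≤ inner ℝ (p i) (y i) := by
  rcases hi.eq_or_lt with rfl | hi
  · exact hT
  obtain ⟨k, rfl⟩ : ∃ k, N = i + (k + 1) := ⟨N - i - 1, by omega⟩
  have h1 := H.energy_of_undisturbed (i := i) (k := k + 1) le_rfl
    (fun j hj => hζ _ (by omega) (by omega))
  have h2 := H.norm_sq_le_sum_dissipation hl hm (i := i) (k := k + 1) le_rfl (Nat.succ_pos k)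
  have : 0 ≤ m * ‖y (i + (k + 1))‖ ^ 2 := by positivity
  rw [add_zero] at h2
  linarith

theorem inner_nonpos_of_undisturbed_before (H : Extremal 𝒜 ℬ N m l y v ζ p g r) (hl : 0 < l)
    (hm : 0 < m) (h0 : y 0 = 0) {i : ℕ} (hi : i ≤ N) (hζ : ∀ j < i, ζ j = 0) :
    inner ℝ (p i) (y i) ≤ 0 := by
  have h1 := H.energy_of_undisturbed (i := 0) (k := i) (by omega) (by simpa using hζ)
  have h2 := H.sum_dissipation_nonneg hl hm (i := 0) (k := i) (by omega)
  rw [h0, inner_zero_right, zero_add] at h1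
  linarith

/-- Response to a perturbation of the initial state. -/
theorem norm_le_of_initial (H : Extremal 𝒜 ℬ N m l y v ζ p g r) (R : Rates d m L μ lam C)
    (hl : 0 < l) (hst : Steerable 𝒜 ℬ N d l L) (hdN : d ≤ N) (hζ : ∀ j < N, ζ j = 0)
    (hT : m * ‖y N‖ ^ 2 ≤ inner ℝ (p N) (y N)) {h : ℕ} (hh : h ≤ N) :
    ‖y h‖ ≤ C * (lam ^ h * ‖y 0‖) := by
  have hd := R.d_pos
  have hm := R.m_pos
  have hL := R.L_pos
  have hs : ∀ i ≤ N, m * ‖y i‖ ^ 2 ≤ inner ℝ (p i) (y i) := fun i hi =>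
    H.norm_sq_le_inner_of_undisturbed_after hl hm hT hi fun j _ hj => hζ j hj
  have hb := H.costate_bound hl hm hL hd hst (i := 0) le_rfl (by omega) (by omega)
  have he := H.energy_of_undisturbed (i := 0) (k := d) (by omega)
    (fun j hj => hζ _ (by omega))
  have hsd := hs (0 + d) (by omega)
  have hyd : 0 ≤ m * ‖y (0 + d)‖ ^ 2 := by positivity
  set q := p 0 - m • y 0 with hq
  have e1 : inner ℝ (p 0) (y 0) = inner ℝ q (y 0) + m * ‖y 0‖ ^ 2 := by
    rw [hq, inner_sub_left, real_inner_smul_left, real_inner_self_eq_norm_sq]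
    ring
  have hqy : inner ℝ q (y 0) ≤ ‖q‖ * ‖y 0‖ := real_inner_le_norm _ _
  have hqn : ‖q‖ ≤ L * ‖y 0‖ := by
    have h1 : ‖q‖ ^ 2 ≤ L * (‖q‖ * ‖y 0‖) := by
      have : L * (∑ j ∈ range d, dissipation y v g r (0 + j) - m * ‖y 0‖ ^ 2)
          ≤ L * (‖q‖ * ‖y 0‖) := by
        gcongr
        linarith
      nlinarith [sq_nonneg ‖p (0 + d)‖]
    rcases (norm_nonneg q).eq_or_lt with h0 | h0
    · rw [← h0]; positivity
    · nlinarith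
  have hqe : inner ℝ q (y 0) ≤ L * ‖y 0‖ ^ 2 := by nlinarith [norm_nonneg (y 0)]
  rcases lt_or_ge h d with hhd | hhd
  · rcases Nat.eq_zero_or_pos h with rfl | hpos
    · rw [pow_zero, one_mul]
      nlinarith [R.four_le_C, norm_nonneg (y 0)]
    refine R.le_of_energy hhd (norm_nonneg _) ?_
    have h1 := H.energy_of_undisturbed (i := 0) (k := h) (by omega) (fun j hj => hζ _ (by omega))
    have h2 := hs (0 + h) (by omega)
    have h3 := H.norm_sq_le_sum_dissipation hl hm (i := 0) (k := h) (by omega) hpos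
    simp only [zero_add] at h1 h2 h3
    linarith
  · have hS : ∀ i ≤ N, m / 2 * ‖y i‖ ^ 2 ≤ storage m y p i := by
      intro i hi
      have := hs i hi
      unfold storage
      linarith
    have h1 := H.storage_decay_forward R hl hst (i := 0) (k := h) hhd (by omega)
      (fun j hj => hζ _ (by omega))
      (fun j hj => le_trans (by positivity) (hS (0 + j) (by omega)))
    have h2 := hS h hh
    refine R.le_of_storage (K := L + m / 2) (norm_nonneg _) ?_ ?_
    · have := R.C_mul_μ
      nlinarith [R.four_le_C, R.μ_lt_one, R.μ_pos, mul_pos hm R.C_pos]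
    · rw [zero_add] at h1
      refine h2.trans (h1.trans ?_)
      gcongr
      unfold storage
      linarith

/-- Response to a perturbation of the terminal state. -/
theorem norm_le_of_terminal (H : Extremal 𝒜 ℬ N m l y v ζ p g r) (R : Rates d m L μ lam C)
    (hl : 0 < l) (hst : Steerable 𝒜 ℬ N d l L) (hdN : d ≤ N) (hζ : ∀ j < N, ζ j = 0)
    (h0 : y 0 = 0) {h : ℕ} (hh : h ≤ N) :
    ‖y h‖ ≤ C * (lam ^ (N - h) * ‖y N‖) := by
  have hd := R.d_pos
  have hm := R.m_pos
  have hL := R.L_pos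
  have hs : ∀ i ≤ N, inner ℝ (p i) (y i) ≤ 0 := fun i hi =>
    H.inner_nonpos_of_undisturbed_before hl hm h0 hi fun j hj => hζ j (by omega)
  obtain ⟨i, rfl⟩ : ∃ i, N = i + d := ⟨N - d, by omega⟩
  have hb := H.costate_bound hl hm hL hd hst (i := i) le_rfl (by omega) le_rfl
  have he := H.energy_of_undisturbed (i := i) (k := d) le_rfl
    (fun j hj => hζ _ (by omega))
  have hsi := hs i (by omega)
  have hyi : 0 ≤ m * ‖y i‖ ^ 2 := by positivity
  set q := p (i + d) with hq
  set z := y (i + d) with hz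
  have hqz : -inner ℝ q z ≤ ‖q‖ * ‖z‖ := by
    rw [← inner_neg_left, ← norm_neg q]
    exact real_inner_le_norm _ _
  have hqn : ‖q‖ ≤ L * ‖z‖ := by
    have h1 : ‖q‖ ^ 2 ≤ L * (‖q‖ * ‖z‖) := by
      have : L * (∑ j ∈ range d, dissipation y v g r (i + j) - m * ‖y i‖ ^ 2)
          ≤ L * (‖q‖ * ‖z‖) := by
        gcongr
        linarith
      nlinarith [sq_nonneg ‖p i - m • y i‖]
    rcases (norm_nonneg q).eq_or_lt with h0 | h0
    · rw [← h0]; positivity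
    · nlinarith
  have hqe : -inner ℝ q z ≤ L * ‖z‖ ^ 2 := by nlinarith [norm_nonneg z]
  rcases lt_or_ge (i + d - h) d with hhd | hhd
  · rcases hh.eq_or_lt with rfl | hlt
    · rw [Nat.sub_self, pow_zero, one_mul]
      nlinarith [R.four_le_C, norm_nonneg z]
    refine R.le_of_energy hhd (norm_nonneg _) ?_
    obtain ⟨k, hk⟩ : ∃ k, i + d = h + (k + 1) := ⟨i + d - h - 1, by omega⟩
    have h1 := H.energy_of_undisturbed (i := h) (k := k + 1) (by omega)
      (fun j hj => hζ _ (by omega))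
    have h2 := hs h (by omega)
    have h3 := H.norm_sq_le_sum_dissipation hl hm (i := h) (k := k + 1) (by omega) (Nat.succ_pos k)
    rw [← hk] at h1
    rw [add_zero] at h3
    linarith
  · have hS : ∀ i' ≤ i + d, m / 2 * ‖y i'‖ ^ 2 ≤ -storage m y p i' := by
      intro i' hi
      have := hs i' hi
      unfold storage
      linarith
    have h1 := H.storage_decay_backward R hl hst (i := h) (k := i + d - h) hhd (by omega)
      (fun j hj => hζ _ (by omega))
      (fun j hj => by
        have h1 := hS (h + j) (by omega)
        have h2 : 0 ≤ m / 2 * ‖y (h + j)‖ ^ 2 := by positivity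
        linarith)
    have h2 := hS h hh
    refine R.le_of_storage (K := L + m / 2) (norm_nonneg _) ?_ ?_
    · have := R.C_mul_μ
      nlinarith [R.four_le_C, R.μ_lt_one, R.μ_pos, mul_pos hm R.C_pos]
    · rw [Nat.add_sub_cancel' hh] at h1
      refine h2.trans (h1.trans ?_)
      gcongr
      unfold storage
      linarith

/-- Response to a perturbation of one disturbance. -/
theorem norm_le_of_impulse (H : Extremal 𝒜 ℬ N m l y v ζ p g r) (R : Rates d m L μ lam C)
    (hl : 0 < l) (hst : Steerable 𝒜 ℬ N d l L) (hab : Absorbing 𝒜 ℬ N d l L) (hdN : d ≤ N)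
    (h0 : y 0 = 0) {s : ℕ} (hsN : s < N) (hζ : ∀ j < N, j ≠ s → ζ j = 0)
    (hT : m * ‖y N‖ ^ 2 ≤ inner ℝ (p N) (y N)) {h : ℕ} (hh : h ≤ N) :
    ‖y h‖ ≤ C * (lam ^ ((h : ℤ) - s).natAbs * ‖ζ s‖) := by
  have hd := R.d_pos
  have hm := R.m_pos
  have hL := R.L_pos
  have hafter : ∀ i, s < i → i ≤ N → m * ‖y i‖ ^ 2 ≤ inner ℝ (p i) (y i) := fun i hi hiN =>
    H.norm_sq_le_inner_of_undisturbed_after hl hm hT hiN fun j hj hjN => hζ j hjN (by omega)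
  have hbefore : ∀ i ≤ s, inner ℝ (p i) (y i) ≤ 0 := fun i hi =>
    H.inner_nonpos_of_undisturbed_before hl hm h0 (by omega)
      fun j hj => hζ j (by omega) (by omega)
  -- the total dissipation is the work done by the disturbance
  have htot := H.energy (i := 0) (k := N) (by omega)
  rw [h0, inner_zero_right, zero_add, sum_eq_single s
    (fun j hj hjs => by
      rw [zero_add, hζ j (mem_range.1 hj) hjs, inner_zero_right])
    (fun hs => absurd (mem_range.2 hsN) hs)] at htot
  simp only [zero_add] at htot
  set E := ∑ j ∈ range N, dissipation y v g r j with hE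
  have hE0 : 0 ≤ E := by
    have := H.sum_dissipation_nonneg hl hm (i := 0) (k := N) (by omega)
    simpa using this
  have hpN : 0 ≤ inner ℝ (p N) (y N) := le_trans (by positivity) hT
  have hwork : inner ℝ (p (s + 1)) (ζ s) ≤ ‖p (s + 1)‖ * ‖ζ s‖ := real_inner_le_norm _ _
  have hps : ‖p (s + 1)‖ ^ 2 ≤ L * E := by
    obtain ⟨i, j, hij, hj, hi⟩ : ∃ i j, s = i + j ∧ j < d ∧ i + d ≤ N :=
      ⟨min s (N - d), s - min s (N - d), by omega, by omega, by omega⟩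
    rw [hij]
    refine (H.costate_bound_inside hl hm hL hab hj hi).trans ?_
    gcongr
    exact H.sum_dissipation_le hl hm hi
  have hpn : ‖p (s + 1)‖ ≤ L * ‖ζ s‖ := by
    have h1 : ‖p (s + 1)‖ ^ 2 ≤ L * (‖p (s + 1)‖ * ‖ζ s‖) :=
      hps.trans (by gcongr; linarith)
    rcases (norm_nonneg (p (s + 1))).eq_or_lt with h0 | h0
    · rw [← h0]; positivity
    · nlinarith
  have hEle : inner ℝ (p N) (y N) + E ≤ L * ‖ζ s‖ ^ 2 := by nlinarith [norm_nonneg (ζ s)]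
  have hyE : m * ‖y h‖ ^ 2 ≤ L * ‖ζ s‖ ^ 2 := by
    rcases hh.eq_or_lt with rfl | hlt
    · linarith
    · have := H.norm_sq_le_sum_dissipation hl hm (i := 0) (k := N) (by omega) hlt
      simp only [zero_add] at this
      linarith
  rcases lt_or_ge ((h : ℤ) - s).natAbs d with hnear | hfar
  · exact R.le_of_energy hnear (norm_nonneg _) hyE
  rcases le_or_gt h s with hhs | hhs
  · -- before the disturbance
    obtain ⟨k, rfl⟩ : ∃ k, s = h + k := ⟨s - h, by omega⟩
    have hk : ((h : ℤ) - (h + k : ℕ)).natAbs = k := by omega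
    rw [hk] at hfar ⊢
    have hS : ∀ i ≤ h + k, m / 2 * ‖y i‖ ^ 2 ≤ -storage m y p i := by
      intro i hi
      have := hbefore i hi
      unfold storage
      linarith
    have h1 := H.storage_decay_backward R hl hst (i := h) (k := k) hfar (by omega)
      (fun j hj => hζ _ (by omega) (by omega))
      (fun j hj => by
        have h1 := hS (h + j) (by omega)
        have h2 : 0 ≤ m / 2 * ‖y (h + j)‖ ^ 2 := by positivity
        linarith)
    have h2 := hS h (by omega)
    have h3 : -storage m y p (h + k) ≤ (3 / 2 * L) * ‖ζ (h + k)‖ ^ 2 := by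
      have h4 := H.energy_of_undisturbed (i := 0) (k := h + k) (by omega)
        (fun j hj => hζ _ (by omega) (by omega))
      have h5 := H.sum_dissipation_le hl hm (i := 0) (k := h + k) (by omega)
      have h6 := H.norm_sq_le_sum_dissipation hl hm (i := 0) (k := N) (by omega) hsN
      rw [h0, inner_zero_right] at h4
      simp only [zero_add] at h4 h5 h6
      unfold storage
      linarith
    refine R.le_of_storage (K := 3 / 2 * L) (norm_nonneg _) ?_ ?_
    · have := R.C_mul_μ
      nlinarith [R.four_le_C, R.μ_lt_one, R.μ_pos, mul_pos hm R.C_pos]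
    · refine h2.trans (h1.trans ?_)
      gcongr
  · -- after the disturbance: the first block starts at the disturbance
    obtain ⟨k, k', hkk, hdk, hk, hk'⟩ : ∃ k k', h = s + k + k' ∧ d ≤ k ∧ k ≤ 2 * d - 1 ∧
        (k' = 0 ∨ d ≤ k') := by
      rcases le_or_gt (h - s) (2 * d - 1) with h1 | h1
      · exact ⟨h - s, 0, by omega, by omega, h1, Or.inl rfl⟩
      · exact ⟨d, h - s - d, by omega, le_rfl, by omega, Or.inr (by omega)⟩
    have hb := H.costate_bound hl hm hL hd hst (i := s) hdk hk (by omega)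
    have hP : ‖p (s + k)‖ ≤ L * ‖ζ s‖ := by
      refine le_of_sq_le_sq ?_ (by positivity)
      have h1 := H.sum_dissipation_le hl hm (i := s) (k := k) (by omega)
      have h2 : L * (∑ j ∈ range k, dissipation y v g r (s + j) - m * ‖y s‖ ^ 2) ≤
          L * (L * ‖ζ s‖ ^ 2) := by
        have : 0 ≤ m * ‖y s‖ ^ 2 := by positivity
        gcongr
        linarith
      nlinarith [sq_nonneg ‖p s - m • y s‖]
    have hS : ∀ i, s < i → i ≤ N → m / 2 * ‖y i‖ ^ 2 ≤ storage m y p i := by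
      intro i hi hiN
      have := hafter i hi hiN
      unfold storage
      linarith
    have h1 : storage m y p h ≤ (lam ^ k') ^ 2 * storage m y p (s + k) := by
      rcases hk' with rfl | hk'
      · simp [hkk]
      · rw [hkk]
        exact H.storage_decay_forward R hl hst hk' (by omega)
          (fun j hj => hζ _ (by omega) (by omega))
          (fun j hj => le_trans (by positivity) (hS (s + k + j) (by omega) (by omega)))
    have h2 : m * storage m y p (s + k) ≤ L ^ 2 / 2 * ‖ζ s‖ ^ 2 := by
      have h3 : inner ℝ (p (s + k)) (y (s + k)) ≤ L * ‖ζ s‖ * ‖y (s + k)‖ :=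
        (real_inner_le_norm _ _).trans (by gcongr)
      unfold storage
      nlinarith [sq_nonneg (L * ‖ζ s‖ - m * ‖y (s + k)‖)]
    have h3 : ‖y h‖ ≤ L / m * (lam ^ k' * ‖ζ s‖) := by
      have hlam := R.lam_pos
      refine le_of_sq_le_sq ?_ (by positivity)
      have h4 := mul_le_mul_of_nonneg_left ((hS h hhs hh).trans h1) (by positivity : 0 ≤ 2 * m)
      have h5 := mul_le_mul_of_nonneg_left h2 (by positivity : 0 ≤ 2 * (lam ^ k') ^ 2)
      have h6 : m ^ 2 * ‖y h‖ ^ 2 ≤ L ^ 2 * (lam ^ k' * ‖ζ s‖) ^ 2 := by linarith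
      rw [mul_pow, div_pow, div_mul_eq_mul_div, le_div_iff₀ (by positivity)]
      linarith
    have hk2 : ((h : ℤ) - s).natAbs = k + k' := by omega
    rw [hk2]
    have hlam := R.lam_pos
    have h4 : L / m ≤ C * lam ^ k := by
      have h5 : μ ≤ lam ^ k := by
        rw [← R.lam_pow]
        exact pow_le_pow_of_le_one R.lam_pos.le R.lam_le_one hk
      have := R.C_mul_μ
      have h6 : C * μ ≤ C * lam ^ k := by have := R.C_pos; gcongr
      rw [div_le_iff₀ hm]
      nlinarith
    refine h3.trans ?_
    calc L / m * (lam ^ k' * ‖ζ s‖) ≤ C * lam ^ k * (lam ^ k' * ‖ζ s‖) := by gcongr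
      _ = _ := by rw [pow_add]; ring

end Extremal

end Abstract

/-! ### Steering -/

/-- A linear map whose first `dim F` singular values are at least `σ` has a right inverse of norm
at most `σ⁻¹`: restrict to the span of the corresponding right singular vectors. -/
theorem exists_preimage_of_le_singularValues {E F : Type*} [NormedAddCommGroup E]
    [InnerProductSpace ℝ E] [FiniteDimensional ℝ E] [NormedAddCommGroup F] [InnerProductSpace ℝ F]
    [FiniteDimensional ℝ F] (M : E →ₗ[ℝ] F) {σ : ℝ} (hσ : 0 < σ)
    (h : ∀ i < Module.finrank ℝ F, σ ≤ M.singularValues i) (e : F) :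
    ∃ u, M u = e ∧ σ ^ 2 * ‖u‖ ^ 2 ≤ ‖e‖ ^ 2 := by
  set n := Module.finrank ℝ F with hn
  have hnN : n ≤ Module.finrank ℝ E := by
    by_contra! hlt
    have := h _ hlt
    rw [M.singularValues_of_finrank_le le_rfl] at this
    linarith
  have hT := M.isSymmetric_adjoint_comp_self
  set bs := hT.eigenvectorBasis rfl with hbs
  have hon : Orthonormal ℝ (fun i : Fin n => bs (Fin.castLE hnN i)) :=
    bs.orthonormal.comp _ (Fin.castLE_injective hnN)
  let J : EuclideanSpace ℝ (Fin n) →ₗ[ℝ] E :=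
    { toFun := fun x => ∑ i, x i • bs (Fin.castLE hnN i)
      map_add' := fun x y => by simp [add_smul, sum_add_distrib]
      map_smul' := fun a x => by simp [mul_smul, smul_sum] }
  have hJ : ∀ x, ‖J x‖ ^ 2 = ∑ i, x i ^ 2 := by
    intro x
    rw [← real_inner_self_eq_norm_sq]
    simp only [J, LinearMap.coe_mk, AddHom.coe_mk]
    rw [hon.inner_sum]
    simp [sq]
  have hbound : ∀ x, σ ^ 2 * ‖J x‖ ^ 2 ≤ ‖M (J x)‖ ^ 2 := by
    intro x
    have e1 : (LinearMap.adjoint M ∘ₗ M) (J x) =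
        ∑ i, (hT.eigenvalues rfl (Fin.castLE hnN i) * x i) • bs (Fin.castLE hnN i) := by
      simp only [J, LinearMap.coe_mk, AddHom.coe_mk, map_sum, map_smul]
      refine sum_congr rfl fun i _ => ?_
      rw [hbs, hT.apply_eigenvectorBasis, smul_smul, mul_comm]
      rfl
    have e2 : ‖M (J x)‖ ^ 2 = ∑ i, hT.eigenvalues rfl (Fin.castLE hnN i) * x i ^ 2 := by
      rw [← real_inner_self_eq_norm_sq, ← LinearMap.adjoint_inner_left, ← LinearMap.comp_apply, e1]
      simp only [J, LinearMap.coe_mk, AddHom.coe_mk]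
      rw [hon.inner_sum]
      simp [sq, mul_assoc]
    rw [e2, hJ, mul_sum]
    refine sum_le_sum fun i _ => ?_
    gcongr
    rw [← M.sq_singularValues_fin rfl]
    gcongr
    exact h _ i.2
  have hinj : Function.Injective (M ∘ₗ J) := by
    rw [injective_iff_map_eq_zero]
    intro x hx
    have h1 := hbound x
    rw [LinearMap.comp_apply] at hx
    rw [hx, hJ, norm_zero] at h1
    have h2 : ∑ i, x i ^ 2 = 0 := by
      refine le_antisymm ?_ (sum_nonneg fun i _ => sq_nonneg _)
      have : 0 < σ ^ 2 := by positivity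
      nlinarith
    ext i
    have := (sum_eq_zero_iff_of_nonneg (fun i _ => sq_nonneg (x i))).1 h2 i (mem_univ i)
    simpa using this
  have hsurj : Function.Surjective (M ∘ₗ J) :=
    (LinearMap.injective_iff_surjective_of_finrank_eq_finrank (by simp [hn])).1 hinj
  obtain ⟨x, hx⟩ := hsurj e
  exact ⟨J x, hx, hx ▸ hbound x⟩

/-- Minkowski's inequality for a free and a forced response, together with the control itself. -/
theorem sum_norm_add_sq_add_le {X U : Type*} [NormedAddCommGroup X]
    [NormedAddCommGroup U] {k : ℕ} {w z : ℕ → X} {u : ℕ → U} {α β γ : ℝ} (hα : 0 ≤ α)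
    (hβ : 0 ≤ β) (hγ : 0 ≤ γ) (hw : ∑ j ∈ range k, ‖w j‖ ^ 2 ≤ α ^ 2)
    (hz : ∑ j ∈ range k, ‖z j‖ ^ 2 ≤ β ^ 2) (hu : ∑ j ∈ range k, ‖u j‖ ^ 2 ≤ γ ^ 2) :
    ∑ j ∈ range k, (‖w j + z j‖ ^ 2 + ‖u j‖ ^ 2) ≤ (α + β + γ) ^ 2 := by
  have hcs : (∑ j ∈ range k, ‖w j‖ * ‖z j‖) ^ 2 ≤ (α * β) ^ 2 := by
    refine (sum_mul_sq_le_sq_mul_sq _ _ _).trans ?_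
    rw [mul_pow]
    gcongr
  have hcs' : ∑ j ∈ range k, ‖w j‖ * ‖z j‖ ≤ α * β := le_of_sq_le_sq hcs (by positivity)
  have h1 : ∑ j ∈ range k, ‖w j + z j‖ ^ 2 ≤ (α + β) ^ 2 := by
    calc _ ≤ ∑ j ∈ range k, (‖w j‖ ^ 2 + 2 * (‖w j‖ * ‖z j‖) + ‖z j‖ ^ 2) := by
          refine sum_le_sum fun j _ => ?_
          have := norm_add_le (w j) (z j)
          nlinarith [norm_nonneg (w j + z j)]
      _ ≤ _ := by
        rw [sum_add_distrib, sum_add_distrib, ← mul_sum]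
        linarith
  rw [sum_add_distrib]
  nlinarith [mul_nonneg (add_nonneg hα hβ) hγ]

section Steering

variable {X U : Type*} [NormedAddCommGroup X] [InnerProductSpace ℝ X]
  [NormedAddCommGroup U] [InnerProductSpace ℝ U]

/-- The trajectory with initial state `x` and forcing `φ`, over the time-varying dynamics `𝒜`. -/
def orbit (𝒜 : ℕ → X →ₗ[ℝ] X) (φ : ℕ → X) (x : X) : ℕ → X
  | 0 => x
  | j + 1 => 𝒜 j (orbit 𝒜 φ x j) + φ j

/-- `geom a j = 1 + a ^ 2 + ⋯ + a ^ (2 * (j - 1))`, which bounds the squared gain from controls to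
the state after `j` steps, up to the factor `b ^ 2`. -/
noncomputable def geom (a : ℝ) (j : ℕ) : ℝ := ∑ i ∈ range j, a ^ (2 * i)

theorem geom_nonneg (a : ℝ) (j : ℕ) : 0 ≤ geom a j :=
  sum_nonneg fun i _ => by rw [pow_mul]; positivity

theorem geom_succ (a : ℝ) (j : ℕ) : geom a (j + 1) = a ^ 2 * geom a j + 1 := by
  unfold geom
  rw [sum_range_succ', mul_sum, mul_zero, pow_zero]
  congr 1
  exact sum_congr rfl fun i _ => by ring

theorem geom_mono (a : ℝ) : Monotone (geom a) := fun i j hij =>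
  sum_le_sum_of_subset_of_nonneg (range_mono hij) fun i _ _ => by rw [pow_mul]; positivity

theorem norm_orbit_le {𝒜 : ℕ → X →ₗ[ℝ] X} {a : ℝ} {k : ℕ} (ha : 0 ≤ a)
    (hA : ∀ j < k, ∀ x, ‖𝒜 j x‖ ≤ a * ‖x‖) (x : X) :
    ∀ j ≤ k, ‖orbit 𝒜 0 x j‖ ≤ a ^ j * ‖x‖
  | 0, _ => by simp [orbit]
  | j + 1, hj => by
    have h := norm_orbit_le ha hA x j (by omega)
    simp only [orbit, Pi.zero_apply, add_zero]
    refine (hA j (by omega) _).trans ?_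
    calc _ ≤ a * (a ^ j * ‖x‖) := by gcongr
      _ = _ := by ring

theorem norm_orbit_sq_le {𝒜 : ℕ → X →ₗ[ℝ] X} {ℬ : ℕ → U →ₗ[ℝ] X} {a b : ℝ} {k : ℕ} (ha : 0 ≤ a)
    (hb : 0 ≤ b) (hA : ∀ j < k, ∀ x, ‖𝒜 j x‖ ≤ a * ‖x‖) (hB : ∀ j < k, ∀ u, ‖ℬ j u‖ ≤ b * ‖u‖)
    (u : ℕ → U) :
    ∀ j ≤ k, ‖orbit 𝒜 (fun j => ℬ j (u j)) 0 j‖ ^ 2 ≤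
      b ^ 2 * geom a j * ∑ i ∈ range j, ‖u i‖ ^ 2
  | 0, _ => by simp [orbit]
  | j + 1, hj => by
    have h := norm_orbit_sq_le ha hb hA hB u j (by omega)
    simp only [orbit]
    set w := orbit 𝒜 (fun j => ℬ j (u j)) 0 j
    set V := ∑ i ∈ range j, ‖u i‖ ^ 2
    have hV : 0 ≤ V := sum_nonneg fun i _ => by positivity
    have hG := geom_nonneg a j
    have h1 : ‖𝒜 j w + ℬ j (u j)‖ ≤ a * ‖w‖ + b * ‖u j‖ :=
      (norm_add_le _ _).trans (add_le_add (hA j (by omega) _) (hB j (by omega) _))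
    have hs : ‖w‖ ≤ √(b ^ 2 * geom a j * V) := Real.le_sqrt_of_sq_le h
    have hs2 : √(b ^ 2 * geom a j * V) = b * (√(geom a j) * √V) := by
      rw [Real.sqrt_mul (by positivity), Real.sqrt_mul (by positivity), Real.sqrt_sq hb, mul_assoc]
    rw [hs2] at hs
    rw [sum_range_succ, geom_succ]
    calc _ ≤ (a * ‖w‖ + b * ‖u j‖) ^ 2 := by gcongr
      _ ≤ (a * (b * (√(geom a j) * √V)) + b * ‖u j‖) ^ 2 := by gcongr
      _ = b ^ 2 * ((a * √(geom a j)) * √V + 1 * ‖u j‖) ^ 2 := by ring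
      _ ≤ b ^ 2 * (((a * √(geom a j)) ^ 2 + 1 ^ 2) * (√V ^ 2 + ‖u j‖ ^ 2)) := by
        gcongr
        nlinarith [sq_nonneg ((a * √(geom a j)) * ‖u j‖ - 1 * √V)]
      _ = _ := by
        rw [mul_pow, Real.sq_sqrt hG, Real.sq_sqrt hV]
        ring

/-- Superposition of a free and a forced trajectory. -/
theorem orbit_add (𝒜 : ℕ → X →ₗ[ℝ] X) (φ ψ : ℕ → X) (x z : X) :
    ∀ j, orbit 𝒜 (φ + ψ) (x + z) j = orbit 𝒜 φ x j + orbit 𝒜 ψ z j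
  | 0 => rfl
  | j + 1 => by
    simp only [orbit, orbit_add 𝒜 φ ψ x z j, map_add, Pi.add_apply]
    abel

theorem orbit_congr (𝒜 : ℕ → X →ₗ[ℝ] X) {φ ψ : ℕ → X} (x : X) :
    ∀ {k : ℕ}, (∀ j < k, φ j = ψ j) → orbit 𝒜 φ x k = orbit 𝒜 ψ x k
  | 0, _ => rfl
  | k + 1, h => by
    simp only [orbit]
    rw [orbit_congr 𝒜 x fun j hj => h j (by omega), h k (by omega)]

/-- Restarting an orbit after `k` steps. -/
theorem orbit_shift (𝒜 : ℕ → X →ₗ[ℝ] X) (φ : ℕ → X) (x : X) (k : ℕ) :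
    ∀ j, orbit 𝒜 φ x (k + j) =
      orbit (fun j => 𝒜 (k + j)) (fun j => φ (k + j)) (orbit 𝒜 φ x k) j
  | 0 => rfl
  | j + 1 => by
    rw [← add_assoc]
    simp only [orbit]
    rw [orbit_shift 𝒜 φ x k j]

theorem orbit_zero_zero (𝒜 : ℕ → X →ₗ[ℝ] X) : ∀ j, orbit 𝒜 0 0 j = 0
  | 0 => rfl
  | j + 1 => by simp [orbit, orbit_zero_zero 𝒜 j]

/-- Steering with an arbitrary forcing: correct the end point of the free response by a control of
minimal size. -/
theorem exists_steering {𝒜 : ℕ → X →ₗ[ℝ] X} {ℬ : ℕ → U →ₗ[ℝ] X} {a b σ : ℝ} {k : ℕ} (ha : 0 < a)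
    (hb : 0 < b) (hσ : 0 < σ) (hA : ∀ j < k, ∀ x, ‖𝒜 j x‖ ≤ a * ‖x‖)
    (hB : ∀ j < k, ∀ u, ‖ℬ j u‖ ≤ b * ‖u‖)
    (hreach : ∀ e, ∃ u : ℕ → U, orbit 𝒜 (fun j => ℬ j (u j)) 0 k = e ∧
      σ ^ 2 * ∑ j ∈ range k, ‖u j‖ ^ 2 ≤ ‖e‖ ^ 2)
    (φ : ℕ → X) (x z : X) {α ε : ℝ} (hα : 0 ≤ α)
    (hfree : ∑ j ∈ range k, ‖orbit 𝒜 φ x j‖ ^ 2 ≤ α ^ 2) (hε : ‖z - orbit 𝒜 φ x k‖ ≤ ε) :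
    ∃ w u, Evolves 𝒜 ℬ 0 k w u φ ∧ w 0 = x ∧ w k = z ∧
      ∑ j ∈ range k, (‖w j‖ ^ 2 + ‖u j‖ ^ 2) ≤
        (α + (b * √(∑ j ∈ range k, geom a (j + 1)) + 1) * (b * √(geom a k) / σ ^ 2 * ε)) ^ 2 := by
  obtain ⟨u, hu, hub⟩ := hreach (z - orbit 𝒜 φ x k)
  set e := z - orbit 𝒜 φ x k with he
  set ψ : ℕ → X := fun j => ℬ j (u j) with hψ
  set V := ∑ j ∈ range k, ‖u j‖ ^ 2 with hV
  have hV0 : 0 ≤ V := sum_nonneg fun i _ => by positivity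
  have hG := geom_nonneg a k
  have hε0 : 0 ≤ ε := (norm_nonneg _).trans hε
  -- if `e ≠ 0` this says that `σ` is at most the gain `b * √(geom a k)`
  have hgain : σ ^ 2 * ‖e‖ ^ 2 ≤ b ^ 2 * geom a k * ‖e‖ ^ 2 := by
    have h1 := norm_orbit_sq_le ha.le hb.le hA hB u k le_rfl
    rw [hu] at h1
    calc σ ^ 2 * ‖e‖ ^ 2 ≤ σ ^ 2 * (b ^ 2 * geom a k * V) := by gcongr
      _ = b ^ 2 * geom a k * (σ ^ 2 * V) := by ring
      _ ≤ _ := by gcongr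
  have hVb : V ≤ (b * √(geom a k) / σ ^ 2 * ε) ^ 2 := by
    rw [div_mul_eq_mul_div, div_pow, le_div_iff₀ (by positivity), mul_pow, mul_pow,
      Real.sq_sqrt hG]
    calc V * (σ ^ 2) ^ 2 = σ ^ 2 * (σ ^ 2 * V) := by ring
      _ ≤ σ ^ 2 * ‖e‖ ^ 2 := by gcongr
      _ ≤ b ^ 2 * geom a k * ‖e‖ ^ 2 := hgain
      _ ≤ _ := by gcongr
  have hforced : ∑ j ∈ range k, ‖orbit 𝒜 ψ 0 j‖ ^ 2 ≤
      (b * √(∑ j ∈ range k, geom a (j + 1)) * (b * √(geom a k) / σ ^ 2 * ε)) ^ 2 := by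
    have hN : 0 ≤ ∑ j ∈ range k, geom a (j + 1) := sum_nonneg fun j _ => geom_nonneg a _
    calc _ ≤ ∑ j ∈ range k, b ^ 2 * geom a (j + 1) * V := by
          refine sum_le_sum fun j hj => ?_
          have hj := mem_range.1 hj
          refine (norm_orbit_sq_le ha.le hb.le hA hB u j hj.le).trans ?_
          have h1 : geom a j ≤ geom a (j + 1) := geom_mono a (Nat.le_succ j)
          have h2 : ∑ i ∈ range j, ‖u i‖ ^ 2 ≤ V :=
            sum_le_sum_of_subset_of_nonneg (range_mono hj.le) fun i _ _ => by positivity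
          have := geom_nonneg a j
          have := geom_nonneg a (j + 1)
          gcongr
      _ = b ^ 2 * (∑ j ∈ range k, geom a (j + 1)) * V := by rw [← sum_mul, ← mul_sum]
      _ ≤ b ^ 2 * (∑ j ∈ range k, geom a (j + 1)) * (b * √(geom a k) / σ ^ 2 * ε) ^ 2 := by gcongr
      _ = _ := by rw [mul_pow (b * √_), mul_pow b, Real.sq_sqrt hN]
  refine ⟨orbit 𝒜 (φ + ψ) (x + 0), u, ?_, ?_, ?_, ?_⟩
  · intro j _
    simp only [orbit, zero_add, Pi.add_apply, hψ]
    abel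
  · simp [orbit]
  · rw [orbit_add, hu, he]
    abel
  · have h := sum_norm_add_sq_add_le (u := u) hα (by positivity) (by positivity) hfree hforced hVb
    simp only [orbit_add]
    refine h.trans_eq ?_
    ring

/-- `k ≥ d` steps reach every state if `d` steps do: stay at rest for the first `k - d` steps. -/
theorem exists_control_of_le {𝒜 : ℕ → X →ₗ[ℝ] X} {ℬ : ℕ → U →ₗ[ℝ] X} {σ : ℝ} {d k : ℕ}
    (hdk : d ≤ k)
    (h : ∀ e, ∃ u : ℕ → U,
      orbit (fun j => 𝒜 (k - d + j)) (fun j => ℬ (k - d + j) (u j)) 0 d = e ∧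
        σ ^ 2 * ∑ j ∈ range d, ‖u j‖ ^ 2 ≤ ‖e‖ ^ 2) (e : X) :
    ∃ u : ℕ → U, orbit 𝒜 (fun j => ℬ j (u j)) 0 k = e ∧
      σ ^ 2 * ∑ j ∈ range k, ‖u j‖ ^ 2 ≤ ‖e‖ ^ 2 := by
  obtain ⟨u, hu, hub⟩ := h e
  obtain ⟨c, rfl⟩ : ∃ c, k = c + d := ⟨k - d, by omega⟩
  simp only [Nat.add_sub_cancel] at hu
  refine ⟨fun j => if j < c then 0 else u (j - c), ?_, ?_⟩
  · rw [orbit_shift]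
    have h0 : orbit 𝒜 (fun j => ℬ j (if j < c then 0 else u (j - c))) 0 c = 0 := by
      refine Eq.trans (orbit_congr 𝒜 0 fun j hj => ?_) (orbit_zero_zero 𝒜 c)
      simp [hj]
    rw [h0, ← hu]
    simp
  · refine le_trans (le_of_eq ?_) hub
    congr 1
    rw [sum_range_add, sum_eq_zero, zero_add]
    · simp
    · intro j hj
      simp [mem_range.1 hj]

theorem orbit_single (𝒜 : ℕ → X →ₗ[ℝ] X) (s : ℕ) (e : X) :
    (∀ j ≤ s, orbit 𝒜 (Pi.single s e) 0 j = 0) ∧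
      ∀ j, orbit 𝒜 (Pi.single s e) 0 (s + 1 + j) = orbit (fun j => 𝒜 (s + 1 + j)) 0 e j := by
  have h0 : ∀ j ≤ s, orbit 𝒜 (Pi.single s e) 0 j = 0 := fun j hj => by
    refine Eq.trans (orbit_congr 𝒜 0 fun i hi => ?_) (orbit_zero_zero 𝒜 j)
    simp [Pi.single_eq_of_ne (show i ≠ s by omega)]
  refine ⟨h0, fun j => ?_⟩
  rw [orbit_shift]
  have h1 : orbit 𝒜 (Pi.single s e) 0 (s + 1) = e := by
    simp [orbit, h0 s le_rfl]
  rw [h1]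
  congr 1
  funext i
  simp [Pi.single_eq_of_ne (show s + 1 + i ≠ s by omega)]

end Steering

/-! ### The steering constant -/

section Constants

variable {a b σ : ℝ}

theorem geom_one (p : ℕ) : geom 1 p = p := by simp [geom]

theorem sub_one_mul_geom (a : ℝ) (p : ℕ) : (a ^ 2 - 1) * geom a p = a ^ (2 * p) - 1 := by
  induction p with
  | zero => simp [geom]
  | succ p ih =>
    rw [geom_succ, show 2 * (p + 1) = 2 * p + 2 by ring, pow_add]
    linear_combination a ^ 2 * ih

theorem sub_one_sq_mul_sum_geom (a : ℝ) (p : ℕ) :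
    (a ^ 2 - 1) ^ 2 * ∑ j ∈ range p, geom a (j + 1) =
      a ^ (2 * p + 2) - (p + 1) * a ^ 2 + p := by
  induction p with
  | zero => simp
  | succ p ih =>
    rw [sum_range_succ, mul_add, ih]
    have := sub_one_mul_geom a (p + 1)
    push_cast
    rw [show 2 * (p + 1) + 2 = 2 * p + 2 + 2 by ring, pow_add a (2 * p + 2) 2]
    rw [show 2 * (p + 1) = 2 * p + 2 by ring] at this
    linear_combination (a ^ 2 - 1) * this

theorem sum_geom_one (p : ℕ) : ∑ j ∈ range p, geom 1 (j + 1) = (p : ℝ) * (p + 1) / 2 := by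
  induction p with
  | zero => simp
  | succ p ih =>
    rw [sum_range_succ, ih, geom_one]
    push_cast
    ring

theorem le_steerConst (ha : 0 < a) (hb : 0 < b) (hσ : 0 < σ) {p j : ℕ} (hj : j ≤ p) :
    √(geom a (p + 1)) + (b * √(∑ j ∈ range p, geom a (j + 1)) + 1) *
      (b * √(geom a p) / σ ^ 2 * (1 + a ^ j)) ≤ steerConst a b σ p := by
  unfold steerConst
  split_ifs with h1
  · subst h1
    rw [sum_geom_one, geom_one, geom_one, one_pow]
    push_cast
    set s := √(p : ℝ)
    set t := √((p : ℝ) * (p + 1) / 2)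
    set q := √((p : ℝ) + 1)
    have hs : 0 ≤ s := Real.sqrt_nonneg _
    have ht : 0 ≤ t := Real.sqrt_nonneg _
    have hq : 0 ≤ q := Real.sqrt_nonneg _
    have hr : 0 ≤ √((p : ℝ) / 2) := Real.sqrt_nonneg _
    have e1 : (b * t + 1) * (b * s / σ ^ 2 * (1 + 1)) ≤ (b * s / σ ^ 2 * (s + 2) + 1) * (1 + b * t) := by
      have : b * s / σ ^ 2 * (1 + 1) ≤ b * s / σ ^ 2 * (s + 2) + 1 := by
        have : b * s / σ ^ 2 * (1 + 1) ≤ b * s / σ ^ 2 * (s + 2) :=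
          mul_le_mul_of_nonneg_left (by linarith) (by positivity)
        linarith
      calc _ ≤ (b * t + 1) * (b * s / σ ^ 2 * (s + 2) + 1) := by gcongr
        _ = _ := by ring
    nlinarith [mul_nonneg hq hr]
  · have h2 : a ^ 2 - 1 ≠ 0 := by
      have : a ^ 2 - 1 = (a - 1) * (a + 1) := by ring
      rw [this]
      exact mul_ne_zero (sub_ne_zero.2 h1) (by positivity)
    have e1 : (a ^ (2 * p + 2) - 1) / (a ^ 2 - 1) = geom a (p + 1) := by
      rw [div_eq_iff h2, mul_comm (geom _ _), sub_one_mul_geom, mul_add, mul_one]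
    have e2 : (a ^ (2 * p) - 1) / (a ^ 2 - 1) = geom a p := by
      rw [div_eq_iff h2, mul_comm (geom _ _), sub_one_mul_geom]
    have e3 : b * √(a ^ (2 * p + 2) - (p + 1) * a ^ 2 + p) / |a ^ 2 - 1| =
        b * √(∑ j ∈ range p, geom a (j + 1)) := by
      rw [← sub_one_sq_mul_sum_geom, Real.sqrt_mul (sq_nonneg _), Real.sqrt_sq_eq_abs]
      have := abs_pos.2 h2
      field_simp
    have e4 : b * (a ^ (p + 1) + a - 2) / (σ ^ 2 * (a - 1)) =
        b / σ ^ 2 * (1 + ∑ i ∈ range (p + 1), a ^ i) := by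
      have h3 : a - 1 ≠ 0 := sub_ne_zero.2 h1
      rw [geom_sum_eq h1]
      field_simp
      ring
    rw [e1, e2, e3, e4]
    set t := √(∑ j ∈ range p, geom a (j + 1))
    set s := √(geom a p)
    have ht : 0 ≤ t := Real.sqrt_nonneg _
    have hs : 0 ≤ s := Real.sqrt_nonneg _
    have h5 : a ^ j ≤ ∑ i ∈ range (p + 1), a ^ i :=
      single_le_sum (f := fun i => a ^ i) (fun i _ => by positivity) (mem_range.2 (by omega))
    have h6 : b * s / σ ^ 2 * (1 + a ^ j) ≤ b / σ ^ 2 * (1 + ∑ i ∈ range (p + 1), a ^ i) * s := by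
      calc _ ≤ b * s / σ ^ 2 * (1 + ∑ i ∈ range (p + 1), a ^ i) := by gcongr
        _ = _ := by ring
    have h7 : (1 + b) / b = 1 + 1 / b := by field_simp; ring
    rw [h7]
    have h8 : 0 ≤ (1 + 1 / b) * (b * t) := by positivity
    have h9 := mul_le_mul_of_nonneg_left h6 (by positivity : 0 ≤ b * t + 1)
    linarith

theorem steerConst_pos (ha : 0 < a) (hb : 0 < b) (hσ : 0 < σ) (p : ℕ) :
    0 < steerConst a b σ p := by
  refine lt_of_lt_of_le ?_ (le_steerConst ha hb hσ p.zero_le)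
  have h1 : 0 < geom a (p + 1) := by
    rw [geom_succ]
    have := geom_nonneg a p
    positivity
  have := Real.sqrt_pos.2 h1
  positivity

theorem smoothConst_le_L0 (lf mc lc a b σ : ℝ) {d k : ℕ} (hdk : d ≤ k) (hk : k ≤ 2 * d - 1) :
    smoothConst lf mc lc a b σ k ≤ L0 lf mc lc a b σ d :=
  le_csSup ((Set.finite_Icc _ _).image _).bddAbove ⟨k, ⟨hdk, hk⟩, rfl⟩

theorem steerConst_sq_le_L0 {lf mc lc : ℝ} (hmc : 0 < mc) {d k : ℕ} (hdk : d ≤ k)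
    (hk : k ≤ 2 * d - 1) : max lf lc * steerConst a b σ k ^ 2 ≤ L0 lf mc lc a b σ d := by
  refine le_trans ?_ (smoothConst_le_L0 lf mc lc a b σ hdk hk)
  unfold smoothConst
  have : 0 ≤ max lf lc ^ 2 * steerConst a b σ k ^ 4 / mc := by positivity
  linarith

theorem L0_pos {lf mc lc : ℝ} (ha : 0 < a) (hb : 0 < b) (hσ : 0 < σ) (hlf : 0 < lf)
    (hmc : 0 < mc) {d : ℕ} (hd : 1 ≤ d) : 0 < L0 lf mc lc a b σ d := by
  refine lt_of_lt_of_le ?_ (steerConst_sq_le_L0 hmc le_rfl (show d ≤ 2 * d - 1 by omega))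
  have := steerConst_pos ha hb hσ d
  have : 0 < max lf lc := lt_max_of_lt_left hlf
  positivity

/-- With `κ = 1 + 2 * L₀ / m`, the contraction factor is `(√κ - 1) / (√κ + 1)` and the constant
of the bounds is `(√κ + 1) ^ 2`. -/
theorem rates {mf lf mc lc : ℝ} (ha : 0 < a) (hb : 0 < b) (hσ : 0 < σ) (hmf : 0 < mf)
    (hlf : 0 < lf) (hmc : 0 < mc) {d : ℕ} (hd : 1 ≤ d) :
    Rates d mf (L0 lf mc lc a b σ d) (rate0 mf lf mc lc a b σ d) (rate mf lf mc lc a b σ d)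
      (bigC mf lf mc lc a b σ d) ∧ rate mf lf mc lc a b σ d < 1 := by
  have hL := L0_pos (lc := lc) ha hb hσ hlf hmc hd
  set L := L0 lf mc lc a b σ d with hLdef
  set μ := rate0 mf lf mc lc a b σ d with hμ
  set κ := 1 + 2 * L / mf with hκ
  have hκ1 : 1 < κ := by
    have : 0 < 2 * L / mf := by positivity
    linarith
  set s := √κ with hs
  have hs1 : 1 < s := by rw [hs, Real.lt_sqrt (by norm_num)]; linarith
  have hss : s ^ 2 = κ := Real.sq_sqrt (by linarith)
  have hμs : μ = (s - 1) / (s + 1) := by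
    rw [hμ, rate0, ← hLdef, ← hκ, ← hs]
    field_simp
    ring
  have hμ0 : 0 < μ := by rw [hμs]; exact div_pos (by linarith) (by linarith)
  have hμ1 : μ < 1 := by rw [hμs, div_lt_one (by linarith)]; linarith
  have hLm : 2 * L = (s ^ 2 - 1) * mf := by
    rw [hss, hκ]
    field_simp
    ring
  have hexp : (0 : ℝ) < 1 / (2 * (d : ℝ) - 1) := by
    have : (1 : ℝ) ≤ d := by exact_mod_cast hd
    exact div_pos one_pos (by linarith)
  have hlam1 : rate mf lf mc lc a b σ d < 1 := Real.rpow_lt_one hμ0.le hμ1 hexp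
  have hC : bigC mf lf mc lc a b σ d = (s + 1) ^ 2 := by
    have h1 : s - 1 ≠ 0 := by linarith
    rw [bigC, ← hLdef, ← hμ, hμs, hLm]
    field_simp
    ring
  refine ⟨⟨hd, hmf, hL, hμ0, hμ1, ?_, Real.rpow_pos_of_pos hμ0 _, hlam1.le, ?_, ?_, ?_⟩, hlam1⟩
  · rw [hμs]
    field_simp
    linear_combination 2 * hLm
  · rw [rate, ← hμ, ← Real.rpow_natCast, ← Real.rpow_mul hμ0.le]
    have : 1 / (2 * (d : ℝ) - 1) * ((2 * d - 1 : ℕ) : ℝ) = 1 := by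
      rw [Nat.cast_sub (by omega)]
      push_cast
      exact one_div_mul_cancel (by have := one_div_pos.1 hexp; linarith)
    rw [this, Real.rpow_one]
  · rw [hC]
    positivity
  · rw [hC, hμs]
    field_simp
    ring

end Constants

/-! ### The time-varying linear system -/

section System

variable {n m : ℕ}

/-- The linear maps `A_{t}, A_{t+1}, …` of a matrix-valued sequence, seen from time `t`. -/
noncomputable def mapsFrom {k : ℕ} (A : ℕ → Matrix (Fin n) (Fin k) ℝ) (t j : ℕ) :
    Vec k →ₗ[ℝ] Vec n :=
  Matrix.toEuclideanLin (A (t + j))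

theorem mapsFrom_add {k : ℕ} (A : ℕ → Matrix (Fin n) (Fin k) ℝ) (t i : ℕ) :
    (fun j => mapsFrom A t (i + j)) = mapsFrom A (t + i) := by
  funext j
  rw [mapsFrom, mapsFrom, add_assoc]

theorem norm_mapsFrom_le {k : ℕ} {A : ℕ → Matrix (Fin n) (Fin k) ℝ} {t j : ℕ} {a : ℝ}
    (h : ‖A (t + j)‖ ≤ a) (x : Vec k) : ‖mapsFrom A t j x‖ ≤ a * ‖x‖ :=
  (Matrix.l2_opNorm_mulVec (A (t + j)) x).trans (by gcongr)

theorem toEuclideanLin_mul_apply {k l q : ℕ} (A : Matrix (Fin k) (Fin l) ℝ)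
    (B : Matrix (Fin l) (Fin q) ℝ) (x : Vec q) :
    Matrix.toEuclideanLin (A * B) x = Matrix.toEuclideanLin A (Matrix.toEuclideanLin B x) := by
  simp [Matrix.toLpLin_apply, Matrix.mulVec_mulVec]

theorem orbit_eq_sum_transition (A : ℕ → Matrix (Fin n) (Fin n) ℝ) (t : ℕ) (φ : ℕ → Vec n) :
    ∀ k, orbit (mapsFrom A t) φ 0 k =
      ∑ j ∈ range k, Matrix.toEuclideanLin (transition A (t + k) (t + j + 1)) (φ j)
  | 0 => by simp [orbit]
  | k + 1 => by
    rw [orbit, orbit_eq_sum_transition A t φ k, sum_range_succ, map_sum]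
    congr 1
    · refine sum_congr rfl fun j hj => ?_
      have hj := mem_range.1 hj
      rw [mapsFrom, ← toEuclideanLin_mul_apply, transition, transition,
        show t + (k + 1) - (t + j + 1) = (t + k - (t + j + 1)) + 1 by omega, transAux,
        show t + j + 1 + (t + k - (t + j + 1)) = t + k by omega]
    · simp [transition, add_assoc, transAux]

theorem toEuclideanLin_ctrbMatrix (A : ℕ → Matrix (Fin n) (Fin n) ℝ)
    (B : ℕ → Matrix (Fin n) (Fin m) ℝ) (t d : ℕ) (u : EuclideanSpace ℝ (Fin d × Fin m))
    (v : ℕ → Vec m) (hv : ∀ (j : Fin d) (i : Fin m), v j i = u (j, i)) :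
    Matrix.toEuclideanLin (ctrbMatrix A B t d) u =
      orbit (mapsFrom A t) (fun j => mapsFrom B t j (v j)) 0 d := by
  rw [orbit_eq_sum_transition, sum_range]
  simp only [mapsFrom, ← toEuclideanLin_mul_apply]
  ext i
  simp [Matrix.toLpLin_apply, Matrix.mulVec, dotProduct, Fintype.sum_prod_type, ctrbMatrix,
    hv]

/-- Uniform controllability, as reachability by small controls over any window of length at
least `d`. -/
theorem UniformlyControllable.exists_control {T : ℕ} {A : ℕ → Matrix (Fin n) (Fin n) ℝ}
    {B : ℕ → Matrix (Fin n) (Fin m) ℝ} {d : ℕ} {a b σ : ℝ}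
    (H : UniformlyControllable T A B d a b σ) (hσ : 0 < σ) {t k : ℕ} (hdk : d ≤ k)
    (htk : t + k ≤ T) (e : Vec n) :
    ∃ u : ℕ → Vec m, orbit (mapsFrom A t) (fun j => mapsFrom B t j (u j)) 0 k = e ∧
      σ ^ 2 * ∑ j ∈ range k, ‖u j‖ ^ 2 ≤ ‖e‖ ^ 2 := by
  refine exists_control_of_le hdk (fun e => ?_) e
  obtain ⟨u, hu, hub⟩ := exists_preimage_of_le_singularValues _ hσ
    (by simpa using H.sigma_le (t + (k - d)) (by omega)) e
  let v : ℕ → Vec m := fun j => if h : j < d then WithLp.toLp 2 fun i => u (⟨j, h⟩, i) else 0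
  refine ⟨v, ?_, ?_⟩
  · rw [toEuclideanLin_ctrbMatrix A B _ d u v (by intro j i; simp [v])] at hu
    have hB : ∀ j, mapsFrom B t (k - d + j) = mapsFrom B (t + (k - d)) j :=
      congrFun (mapsFrom_add B t (k - d))
    simp only [hB]
    rw [mapsFrom_add]
    exact hu
  · refine le_trans (le_of_eq ?_) hub
    rw [EuclideanSpace.norm_sq_eq, Fintype.sum_prod_type, sum_range]
    congr 1
    refine sum_congr rfl fun j _ => ?_
    rw [EuclideanSpace.norm_sq_eq]
    simp [v]

variable {T : ℕ} {A : ℕ → Matrix (Fin n) (Fin n) ℝ} {B : ℕ → Matrix (Fin n) (Fin m) ℝ} {d : ℕ}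
  {a b σ mf lf mc lc : ℝ}

theorem Evolves.of_shift {X U : Type*} [NormedAddCommGroup X] [InnerProductSpace ℝ X]
    [NormedAddCommGroup U] [InnerProductSpace ℝ U] {𝒜 : ℕ → X →ₗ[ℝ] X} {ℬ : ℕ → U →ₗ[ℝ] X}
    {i k : ℕ} {w : ℕ → X} {u : ℕ → U} {e : ℕ → X}
    (h : Evolves (fun j => 𝒜 (i + j)) (fun j => ℬ (i + j)) 0 k w u e) : Evolves 𝒜 ℬ i k w u e := by
  intro j hj
  simpa using h j hj

theorem UniformlyControllable.steerable (H : UniformlyControllable T A B d a b σ) (ha : 0 < a)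
    (hb : 0 < b) (hσ : 0 < σ) (hlf : 0 < lf) (hmc : 0 < mc) {t p : ℕ} (htp : t + p ≤ T) :
    Steerable (mapsFrom A t) (mapsFrom B t) p d (max lf lc) (L0 lf mc lc a b σ d) := by
  intro i k hdk hk hik x z
  set α := √(geom a (k + 1)) * ‖x‖ with hα
  have hA : ∀ j < k, ∀ x, ‖mapsFrom A (t + i) j x‖ ≤ a * ‖x‖ := fun j hj x =>
    norm_mapsFrom_le (H.norm_A_le _ (by omega)) x
  have hB : ∀ j < k, ∀ u, ‖mapsFrom B (t + i) j u‖ ≤ b * ‖u‖ := fun j hj u =>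
    norm_mapsFrom_le (H.norm_B_le _ (by omega)) u
  obtain ⟨w, u, hw, hw0, hwk, hs⟩ := exists_steering (α := α) (ε := ‖z‖ + a ^ k * ‖x‖) ha hb hσ hA
    hB (fun e => H.exists_control hσ hdk (by omega) e) 0 x z (by positivity) (by
      have : ∑ j ∈ range k, ‖orbit (mapsFrom A (t + i)) 0 x j‖ ^ 2 ≤
          ∑ j ∈ range (k + 1), a ^ (2 * j) * ‖x‖ ^ 2 := by
        rw [sum_range_succ]
        refine le_add_of_le_of_nonneg (sum_le_sum fun j hj => ?_) (by positivity)
        calc _ ≤ (a ^ j * ‖x‖) ^ 2 := by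
              gcongr
              exact norm_orbit_le ha.le hA x j (mem_range.1 hj).le
          _ = _ := by ring
      refine this.trans_eq ?_
      rw [← sum_mul, hα, mul_pow, Real.sq_sqrt (geom_nonneg _ _), geom])
    ((norm_sub_le _ _).trans (by
      gcongr
      exact norm_orbit_le ha.le hA x k le_rfl))
  refine ⟨w, u, Evolves.of_shift (by rwa [mapsFrom_add, mapsFrom_add]), hw0, hwk, ?_⟩
  have hl : 0 < max lf lc := lt_max_of_lt_left hlf
  set M := max ‖x‖ ‖z‖ with hM
  have hM2 : M ^ 2 ≤ ‖x‖ ^ 2 + ‖z‖ ^ 2 := by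
    rcases max_cases ‖x‖ ‖z‖ with h | h <;> rw [hM, h.1] <;> nlinarith [sq_nonneg ‖x‖, sq_nonneg ‖z‖]
  have hxM : ‖x‖ ≤ M := le_max_left _ _
  have hzM : ‖z‖ ≤ M := le_max_right _ _
  have hc := le_steerConst ha hb hσ (le_refl k)
  have h1 : α + (b * √(∑ j ∈ range k, geom a (j + 1)) + 1) *
      (b * √(geom a k) / σ ^ 2 * (‖z‖ + a ^ k * ‖x‖)) ≤ steerConst a b σ k * M := by
    calc _ ≤ √(geom a (k + 1)) * M + (b * √(∑ j ∈ range k, geom a (j + 1)) + 1) *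
          (b * √(geom a k) / σ ^ 2 * (M + a ^ k * M)) := by rw [hα]; gcongr
      _ = (√(geom a (k + 1)) + (b * √(∑ j ∈ range k, geom a (j + 1)) + 1) *
          (b * √(geom a k) / σ ^ 2 * (1 + a ^ k))) * M := by ring
      _ ≤ _ := by gcongr
  calc _ ≤ max lf lc * (steerConst a b σ k * M) ^ 2 := by
        gcongr
        exact hs.trans (by gcongr)
    _ = max lf lc * steerConst a b σ k ^ 2 * M ^ 2 := by ring
    _ ≤ _ := by
      gcongr
      · exact (mul_nonneg hl.le (sq_nonneg _)).trans (steerConst_sq_le_L0 hmc hdk hk)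
      · exact steerConst_sq_le_L0 hmc hdk hk

theorem UniformlyControllable.absorbing (H : UniformlyControllable T A B d a b σ) (ha : 0 < a)
    (hb : 0 < b) (hσ : 0 < σ) (hlf : 0 < lf) (hmc : 0 < mc) {t p : ℕ} (htp : t + p ≤ T) :
    Absorbing (mapsFrom A t) (mapsFrom B t) p d (max lf lc) (L0 lf mc lc a b σ d) := by
  intro i s hsd hik e
  set α := √(geom a (d + 1)) * ‖e‖ with hα
  have hA : ∀ j < d, ∀ x, ‖mapsFrom A (t + i) j x‖ ≤ a * ‖x‖ := fun j hj x =>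
    norm_mapsFrom_le (H.norm_A_le _ (by omega)) x
  have hB : ∀ j < d, ∀ u, ‖mapsFrom B (t + i) j u‖ ≤ b * ‖u‖ := fun j hj u =>
    norm_mapsFrom_le (H.norm_B_le _ (by omega)) u
  obtain ⟨c, hc⟩ : ∃ c, d = s + 1 + c := ⟨d - (s + 1), by omega⟩
  obtain ⟨h0, h1⟩ := orbit_single (mapsFrom A (t + i)) s e
  have h2 : ∀ j ≤ c, ‖orbit (mapsFrom A (t + i)) (Pi.single s e) 0 (s + 1 + j)‖ ≤ a ^ j * ‖e‖ := by
    intro j hj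
    rw [h1]
    exact norm_orbit_le (k := c) ha.le (fun j hj => hA _ (by omega)) e j hj
  obtain ⟨w, u, hw, hw0, hwk, hs⟩ := exists_steering (α := α) (ε := a ^ c * ‖e‖) ha hb hσ hA
    hB (fun e => H.exists_control hσ le_rfl (by omega) e) (Pi.single s e) 0 0 (by positivity) (by
      rw [hα, mul_pow, Real.sq_sqrt (geom_nonneg _ _)]
      calc _ = ∑ j ∈ range c, ‖orbit (mapsFrom A (t + i)) (Pi.single s e) 0 (s + 1 + j)‖ ^ 2 := by
            rw [hc, sum_range_add, sum_eq_zero, zero_add]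
            intro j hj
            rw [h0 j (by have := mem_range.1 hj; omega)]
            simp
        _ ≤ ∑ j ∈ range c, a ^ (2 * j) * ‖e‖ ^ 2 := by
            refine sum_le_sum fun j hj => ?_
            calc _ ≤ (a ^ j * ‖e‖) ^ 2 := by
                  gcongr
                  exact h2 j (mem_range.1 hj).le
              _ = _ := by ring
        _ = geom a c * ‖e‖ ^ 2 := by rw [← sum_mul, geom]
        _ ≤ _ := by
          gcongr
          exact geom_mono a (by omega))
    (by rw [zero_sub, norm_neg]; exact hc ▸ h2 c le_rfl)
  refine ⟨w, u, Evolves.of_shift (by rwa [mapsFrom_add, mapsFrom_add]), hw0, hwk, ?_⟩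
  have hl : 0 < max lf lc := lt_max_of_lt_left hlf
  have hcs := le_steerConst ha hb hσ (show c ≤ d by omega)
  have h3 : α + (b * √(∑ j ∈ range d, geom a (j + 1)) + 1) *
      (b * √(geom a d) / σ ^ 2 * (a ^ c * ‖e‖)) ≤ steerConst a b σ d * ‖e‖ := by
    calc _ = (√(geom a (d + 1)) + (b * √(∑ j ∈ range d, geom a (j + 1)) + 1) *
          (b * √(geom a d) / σ ^ 2 * (a ^ c))) * ‖e‖ := by rw [hα]; ring
      _ ≤ (√(geom a (d + 1)) + (b * √(∑ j ∈ range d, geom a (j + 1)) + 1) *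
          (b * √(geom a d) / σ ^ 2 * (1 + a ^ c))) * ‖e‖ := by gcongr; linarith
      _ ≤ _ := by gcongr
  calc _ ≤ max lf lc * (steerConst a b σ d * ‖e‖) ^ 2 := by
        gcongr
        exact hs.trans (by gcongr)
    _ = max lf lc * steerConst a b σ d ^ 2 * ‖e‖ ^ 2 := by ring
    _ ≤ _ := by
      gcongr
      exact steerConst_sq_le_L0 hmc le_rfl (by omega)

end System

/-! ### Gradients, costates and multipliers -/

section Gradients

variable {n : ℕ} {μ l : ℝ} {h : Vec n → ℝ}

theorem StronglyConvex.norm_sq_le (H : StronglyConvex μ h) (x y : Vec n) :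
    μ * ‖x - y‖ ^ 2 ≤ inner ℝ (gradient h x - gradient h y) (x - y) := by
  have h1 := H x y
  have h2 := H y x
  rw [norm_sub_rev] at h1
  have e : inner ℝ (gradient h x - gradient h y) (x - y) =
      -inner ℝ (gradient h x) (y - x) - inner ℝ (gradient h y) (x - y) := by
    rw [inner_sub_left, ← inner_neg_right, neg_sub]
  linarith

theorem StronglyConvex.le_of_pos (H : StronglyConvex μ h) (hμ : 0 < μ) (x y : Vec n) :
    h x + inner ℝ (gradient h x) (y - x) ≤ h y := by
  have := H x y
  have : 0 ≤ μ / 2 * ‖y - x‖ ^ 2 := by positivity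
  linarith

theorem StronglySmooth.mono {l' : ℝ} (H : StronglySmooth l h) (hl : l ≤ l') :
    StronglySmooth l' h := fun x y => (H x y).trans (by gcongr)

theorem StronglyConvex.cocoercive (H : StronglyConvex μ h) (hμ : 0 < μ) (S : StronglySmooth l h)
    (hl : 0 < l) (x y : Vec n) :
    ‖gradient h x - gradient h y‖ ^ 2 ≤ l * inner ℝ (gradient h x - gradient h y) (x - y) :=
  cocoercive_of_convex_of_smooth hl (H.le_of_pos hμ) S x y

/-- Cocoercivity of the gradient of `h - μ / 2 * ‖·‖ ^ 2`. -/
theorem StronglyConvex.cocoercive_sub (H : StronglyConvex μ h) (hμ : 0 < μ)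
    (S : StronglySmooth l h) (hl : 0 < l) (x y : Vec n) :
    ‖gradient h x - gradient h y - μ • (x - y)‖ ^ 2 ≤
      l * inner ℝ (gradient h x - gradient h y - μ • (x - y)) (x - y) := by
  have e : ∀ x y : Vec n, ‖y‖ ^ 2 = ‖x‖ ^ 2 + 2 * inner ℝ x (y - x) + ‖y - x‖ ^ 2 := by
    intro x y
    rw [← norm_add_sq_real, add_sub_cancel]
  have := cocoercive_of_convex_of_smooth (h := fun x => h x - μ / 2 * ‖x‖ ^ 2)
    (G := fun x => gradient h x - μ • x) hl (fun x y => by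
      have h1 := H x y
      have h2 := e x y
      rw [inner_sub_left, real_inner_smul_left]
      rw [h2]
      linarith) (fun x y => by
      have h1 := S x y
      have h2 := e x y
      have h3 : 0 ≤ μ / 2 * ‖y - x‖ ^ 2 := by positivity
      rw [inner_sub_left, real_inner_smul_left]
      rw [h2]
      linarith) x y
  have e2 : gradient h x - μ • x - (gradient h y - μ • y) =
      gradient h x - gradient h y - μ • (x - y) := by
    rw [smul_sub]
    abel
  rwa [e2] at this

theorem StronglyConvex.le_of_nonneg (H : StronglyConvex μ h) (h0 : h 0 = 0) (hn : ∀ x, 0 ≤ h x)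
    (x : Vec n) : μ / 2 * ‖x‖ ^ 2 ≤ h x := by
  have hmin : IsLocalMin h 0 := Filter.Eventually.of_forall fun x => by rw [h0]; exact hn x
  have hg : gradient h 0 = 0 := by rw [gradient, hmin.fderiv_eq_zero, map_zero]
  have := H 0 x
  rw [hg, h0, inner_zero_left, sub_zero] at this
  linarith

theorem inner_gradient_sub_nonneg_of_convexOn {g : Vec n → ℝ} (hc : ConvexOn ℝ Set.univ g)
    (hd : Differentiable ℝ g) (x y : Vec n) :
    0 ≤ inner ℝ (gradient g x - gradient g y) (x - y) := by
  have key : ∀ x y : Vec n, inner ℝ (gradient g x) (y - x) ≤ g y - g x := by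
    intro x y
    have hφ : ConvexOn ℝ Set.univ (fun s : ℝ => g (AffineMap.lineMap x y s)) :=
      hc.comp_affineMap (AffineMap.lineMap x y)
    have hder : HasDerivAt (fun s : ℝ => g (AffineMap.lineMap x y s))
        (inner ℝ (gradient g x) (y - x)) 0 := by
      have h1 : HasFDerivAt g (fderiv ℝ g x) (AffineMap.lineMap x y (0 : ℝ)) := by
        rw [AffineMap.lineMap_apply_zero]
        exact (hd x).hasFDerivAt
      have h2 := h1.comp_hasDerivAt (0 : ℝ) AffineMap.hasDerivAt_lineMap
      rwa [← inner_gradient_left] at h2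
    have := hφ.le_slope_of_hasDerivAt (Set.mem_univ 0) (Set.mem_univ 1) one_pos hder
    simpa [slope_def_field] using this
  have h1 := key x y
  have h2 := key y x
  have e : inner ℝ (gradient g x - gradient g y) (x - y) =
      -inner ℝ (gradient g x) (y - x) - inner ℝ (gradient g y) (x - y) := by
    rw [inner_sub_left, ← inner_neg_right, neg_sub]
  linarith

end Gradients

section Costates

variable {X U : Type*} [NormedAddCommGroup X] [InnerProductSpace ℝ X]
  [NormedAddCommGroup U] [InnerProductSpace ℝ U]

/-- Backward recursion for the costate. -/
theorem exists_costate [FiniteDimensional ℝ X] (𝒜 : ℕ → X →ₗ[ℝ] X) (g : ℕ → X) (N : ℕ) (q : X) :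
    ∃ p : ℕ → X, p N = q ∧
      ∀ j < N, ∀ w, inner ℝ (p j) w = inner ℝ (g j) w + inner ℝ (p (j + 1)) (𝒜 j w) := by
  let P : ℕ → X := fun i => Nat.rec q
    (fun i x => g (N - i - 1) + LinearMap.adjoint (𝒜 (N - i - 1)) x) i
  refine ⟨fun j => P (N - j), by simp [P], fun j hj w => ?_⟩
  obtain ⟨i, rfl⟩ : ∃ i, N = j + i + 1 := ⟨N - j - 1, by omega⟩
  have h1 : j + i + 1 - j = i + 1 := by omega
  have h2 : j + i + 1 - (j + 1) = i := by omega
  have h3 : P (i + 1) = g j + LinearMap.adjoint (𝒜 j) (P i) := by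
    have : j + i + 1 - i - 1 = j := by omega
    simp only [P, this]
  simp only [h1, h2]
  rw [h3, inner_add_left, LinearMap.adjoint_inner_left]

theorem costate_pairing {𝒜 : ℕ → X →ₗ[ℝ] X} {p g : ℕ → X} {N : ℕ}
    (hp : ∀ j < N, ∀ w, inner ℝ (p j) w = inner ℝ (g j) w + inner ℝ (p (j + 1)) (𝒜 j w))
    (φ : ℕ → X) {k : ℕ} (hk : k ≤ N) :
    ∑ j ∈ range k, inner ℝ (p (j + 1)) (φ j) = inner ℝ (p k) (orbit 𝒜 φ 0 k) +
      ∑ j ∈ range k, inner ℝ (g j) (orbit 𝒜 φ 0 j) := by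
  induction k with
  | zero => simp [orbit]
  | succ k ih =>
    have h1 := ih (by omega)
    have h2 := hp k (by omega) (orbit 𝒜 φ 0 k)
    rw [sum_range_succ, sum_range_succ, h1, h2, orbit, inner_add_right]
    ring

/-- Lagrange multiplier for a linear functional that vanishes on the kernel of a surjection. -/
theorem exists_multiplier {V : Type*} [AddCommGroup V] [Module ℝ V] [FiniteDimensional ℝ X]
    (Λ : V →ₗ[ℝ] X) (hΛ : Function.Surjective Λ) (Ψ : V →ₗ[ℝ] ℝ) (h : ∀ u, Λ u = 0 → Ψ u = 0) :
    ∃ q, ∀ u, Ψ u = inner ℝ q (Λ u) := by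
  obtain ⟨R, hR⟩ := Λ.exists_rightInverse_of_surjective (LinearMap.range_eq_top.2 hΛ)
  refine ⟨(InnerProductSpace.toDual ℝ X).symm (Ψ ∘ₗ R).toContinuousLinearMap, fun u => ?_⟩
  rw [InnerProductSpace.toDual_symm_apply]
  have h1 : Λ (u - R (Λ u)) = 0 := by
    rw [map_sub, sub_eq_zero]
    exact (LinearMap.congr_fun hR (Λ u)).symm
  have h2 := h _ h1
  rw [map_sub, sub_eq_zero] at h2
  simpa using h2

/-- The response to controls from the zero state, as a linear map. -/
noncomputable def zeroStateResponse (𝒜 : ℕ → X →ₗ[ℝ] X) (ℬ : ℕ → U →ₗ[ℝ] X) :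
    ℕ → ((ℕ → U) →ₗ[ℝ] X)
  | 0 => 0
  | j + 1 => 𝒜 j ∘ₗ zeroStateResponse 𝒜 ℬ j + ℬ j ∘ₗ LinearMap.proj j

theorem zeroStateResponse_apply (𝒜 : ℕ → X →ₗ[ℝ] X) (ℬ : ℕ → U →ₗ[ℝ] X) (u : ℕ → U) :
    ∀ j, zeroStateResponse 𝒜 ℬ j u = orbit 𝒜 (fun j => ℬ j (u j)) 0 j
  | 0 => rfl
  | j + 1 => by simp [zeroStateResponse, orbit, zeroStateResponse_apply 𝒜 ℬ u j]

end Costates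

section Telescoping

/-- A function of finitely many variables that is Lipschitz in each of them. -/
theorem norm_sub_le_sum_of_update {ι X E : Type*} [Fintype ι] [DecidableEq ι]
    [SeminormedAddCommGroup X] [SeminormedAddCommGroup E] (φ : (ι → X) → E) (c : ι → ℝ)
    (h : ∀ ζ i e, ‖φ (Function.update ζ i e) - φ ζ‖ ≤ c i * ‖e - ζ i‖) (ζ ζ' : ι → X) :
    ‖φ ζ - φ ζ'‖ ≤ ∑ i, c i * ‖ζ i - ζ' i‖ := by
  have key : ∀ S : Finset ι, ‖φ (S.piecewise ζ ζ') - φ ζ'‖ ≤ ∑ i ∈ S, c i * ‖ζ i - ζ' i‖ := by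
    intro S
    induction S using Finset.induction_on with
    | empty => simp
    | insert i S hi ih =>
      rw [piecewise_insert, sum_insert hi]
      have h1 := h (S.piecewise ζ ζ') i (ζ i)
      rw [piecewise_eq_of_notMem _ _ _ hi] at h1
      refine (norm_sub_le_norm_sub_add_norm_sub _ (φ (S.piecewise ζ ζ')) _).trans ?_
      exact add_le_add h1 ih
  simpa using key univ

end Telescoping

/-! ### First-order optimality -/

section Problem

variable {n m : ℕ} {T : ℕ} {A : ℕ → Matrix (Fin n) (Fin n) ℝ} {B : ℕ → Matrix (Fin n) (Fin m) ℝ}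
  {f : ℕ → Vec n → ℝ} {c : ℕ → Vec m → ℝ} {mf lf mc lc a b σ : ℝ} {d t p : ℕ}

/-- Extension by zero of a finite sequence. -/
def extend {X : Type*} [Zero X] {k : ℕ} (s : Fin k → X) (j : ℕ) : X :=
  if h : j < k then s ⟨j, h⟩ else 0

@[simp]
theorem extend_val {X : Type*} [Zero X] {k : ℕ} (s : Fin k → X) (j : Fin k) :
    extend s j = s j := by
  simp [extend]

theorem extend_sub {X : Type*} [AddGroup X] {k : ℕ} (s r : Fin k → X) (j : ℕ) :
    extend (s - r) j = extend s j - extend r j := by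
  unfold extend
  split_ifs <;> simp

@[simp]
theorem extend_val_add_one {X : Type*} [Zero X] {k : ℕ} (s : Fin (k + 1) → X) (j : Fin k) :
    extend s ((j : ℕ) + 1) = s j.succ :=
  extend_val s j.succ

@[simp]
theorem extend_zero {X : Type*} [Zero X] {k : ℕ} (s : Fin (k + 1) → X) : extend s 0 = s 0 :=
  extend_val s 0

@[simp]
theorem extend_last {X : Type*} [Zero X] {k : ℕ} (s : Fin (k + 1) → X) :
    extend s k = s (Fin.last k) :=
  extend_val s (Fin.last k)

theorem evolves_of_mem_feasible {x : Vec n} {ζ : Fin p → Vec n} {s : Traj n m p}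
    (h : s ∈ feasible A B t x ζ) :
    Evolves (mapsFrom A t) (mapsFrom B t) 0 p (extend s.1) (extend s.2) (extend ζ) := by
  intro j hj
  have h1 := h.2 ⟨j, hj⟩
  have e1 := extend_val_add_one s.1 ⟨j, hj⟩
  have e2 := extend_val s.1 (Fin.castSucc ⟨j, hj⟩)
  have e3 := extend_val s.2 ⟨j, hj⟩
  have e4 := extend_val ζ ⟨j, hj⟩
  simp only [Fin.val_castSucc] at e1 e2 e3 e4
  rw [e1, e2, e3, e4, zero_add, h1]
  rfl

/-- Restriction of a pair of sequences to the horizon. -/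
def restrict (p : ℕ) (w : ℕ → Vec n) (u : ℕ → Vec m) : Traj n m p :=
  (fun j => w j, fun j => u j)

theorem mem_feasible_restrict {w : ℕ → Vec n} {u : ℕ → Vec m} {ζ : Fin p → Vec n} {x : Vec n}
    (h0 : w 0 = x) (h : Evolves (mapsFrom A t) (mapsFrom B t) 0 p w u (extend ζ)) :
    restrict p w u ∈ feasible A B t x ζ := by
  refine ⟨h0, fun j => ?_⟩
  have h1 := h j j.2
  rw [zero_add, extend_val] at h1
  exact h1

theorem add_smul_mem_feasible {x : Vec n} {ζ : Fin p → Vec n} {s : Traj n m p}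
    (hs : s ∈ feasible A B t x ζ) {w : ℕ → Vec n} {u : ℕ → Vec m} (h0 : w 0 = 0)
    (h : Evolves (mapsFrom A t) (mapsFrom B t) 0 p w u 0) (ε : ℝ) :
    s + ε • restrict p w u ∈ feasible A B t x ζ := by
  refine ⟨by simp [restrict, h0, hs.1], fun j => ?_⟩
  have h1 := h j j.2
  have h2 := hs.2 j
  rw [zero_add, Pi.zero_apply, add_zero] at h1
  simp only [restrict, Prod.fst_add, Prod.snd_add, Prod.smul_fst, Prod.smul_snd, Pi.add_apply,
    Pi.smul_apply, Fin.val_succ, Fin.val_castSucc, h1, h2, map_add, map_smul, smul_add]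
  simp only [mapsFrom]
  abel

/-- The first-order variation of the accumulated stage costs in the direction `(w, u)`. -/
noncomputable def variation (f : ℕ → Vec n → ℝ) (c : ℕ → Vec m → ℝ) (t p : ℕ) (y : ℕ → Vec n)
    (v : ℕ → Vec m) (w : ℕ → Vec n) (u : ℕ → Vec m) : ℝ :=
  ∑ j ∈ range p, (inner ℝ (gradient (f (t + j + 1)) (y (j + 1))) (w (j + 1)) +
    inner ℝ (gradient (c (t + j + 1)) (v j)) (u j))

theorem hasDerivAt_line {k : ℕ} {h : Vec k → ℝ} (hd : Differentiable ℝ h) (x w : Vec k) :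
    HasDerivAt (fun ε : ℝ => h (x + ε • w)) (inner ℝ (gradient h x) w) 0 := by
  have h1 : HasFDerivAt h (fderiv ℝ h x) (x + (0 : ℝ) • w) := by
    rw [zero_smul, add_zero]
    exact (hd x).hasFDerivAt
  have h2 : HasDerivAt (fun ε : ℝ => x + ε • w) w 0 := by
    simpa using ((hasDerivAt_id (0 : ℝ)).smul_const w).const_add x
  have h3 := h1.comp_hasDerivAt (0 : ℝ) h2
  rwa [← inner_gradient_left] at h3

theorem WellConditioned.differentiable_f (W : WellConditioned T f c mf lf mc lc) {t : ℕ}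
    (h1 : 1 ≤ t) (h2 : t ≤ T) : Differentiable ℝ (f t) :=
  (W.f_contDiff t h1 h2).differentiable (by norm_num)

theorem WellConditioned.differentiable_c (W : WellConditioned T f c mf lf mc lc) {t : ℕ}
    (h1 : 1 ≤ t) (h2 : t ≤ T) : Differentiable ℝ (c t) :=
  (W.c_contDiff t h1 h2).differentiable (by norm_num)

theorem hasDerivAt_stageCost (W : WellConditioned T f c mf lf mc lc) (htp : t + p ≤ T)
    (s : Traj n m p) (w : ℕ → Vec n) (u : ℕ → Vec m) :
    HasDerivAt (fun ε : ℝ => stageCost f c t (s + ε • restrict p w u))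
      (variation f c t p (extend s.1) (extend s.2) w u) 0 := by
  unfold stageCost variation
  rw [sum_range, sum_add_distrib]
  refine HasDerivAt.add (HasDerivAt.fun_sum fun j _ => ?_) (HasDerivAt.fun_sum fun j _ => ?_)
  · have := hasDerivAt_line (W.differentiable_f (t := t + j + 1) (by omega) (by omega))
      (s.1 j.succ) (w (j + 1))
    simpa [restrict] using this
  · have := hasDerivAt_line (W.differentiable_c (t := t + j + 1) (by omega) (by omega))
      (s.2 j) (u j)
    simpa [restrict] using this

/-- First-order optimality of a feasible trajectory; `q` is the gradient of the terminal cost or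
the multiplier of the terminal constraint. -/
structure IsCritical (A : ℕ → Matrix (Fin n) (Fin n) ℝ) (B : ℕ → Matrix (Fin n) (Fin m) ℝ)
    (f : ℕ → Vec n → ℝ) (c : ℕ → Vec m → ℝ) (t : ℕ) {p : ℕ} (x : Vec n) (ζ : Fin p → Vec n)
    (s : Traj n m p) (q : Vec n) : Prop where
  feasible : s ∈ feasible A B t x ζ
  stationary : ∀ w u, w 0 = 0 → Evolves (mapsFrom A t) (mapsFrom B t) 0 p w u 0 →
    variation f c t p (extend s.1) (extend s.2) w u + inner ℝ q (w p) = 0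

/-- The minimizers of the problem with a differentiable terminal cost are critical. -/
theorem isCritical_of_isMinOn (W : WellConditioned T f c mf lf mc lc) (htp : t + p ≤ T)
    {x : Vec n} {ζ : Fin p → Vec n} {s : Traj n m p} {g : Vec n → ℝ} (hg : Differentiable ℝ g)
    (hs : s ∈ feasible A B t x ζ)
    (hmin : IsMinOn (fun r : Traj n m p => stageCost f c t r + g (r.1 (Fin.last p)))
      (feasible A B t x ζ) s) :
    IsCritical A B f c t x ζ s (gradient g (s.1 (Fin.last p))) := by
  refine ⟨hs, fun w u h0 hw => ?_⟩
  have h1 := (hasDerivAt_stageCost W htp s w u).add (hasDerivAt_line hg (s.1 (Fin.last p)) (w p))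
  refine IsLocalMin.hasDerivAt_eq_zero (Filter.Eventually.of_forall fun ε => ?_) h1
  have := hmin (add_smul_mem_feasible hs h0 hw ε)
  simpa [restrict, Prod.mk_zero_zero] using this

theorem orbit_evolves (𝒜 : ℕ → Vec n →ₗ[ℝ] Vec n) (ℬ : ℕ → Vec m →ₗ[ℝ] Vec n) (u : ℕ → Vec m)
    (e : ℕ → Vec n) (x : Vec n) (k : ℕ) :
    Evolves 𝒜 ℬ 0 k (orbit 𝒜 (e + fun j => ℬ j (u j)) x) u e := by
  intro j _
  simp only [orbit, zero_add, Pi.add_apply]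
  abel

theorem eq_orbit_of_evolves {𝒜 : ℕ → Vec n →ₗ[ℝ] Vec n} {ℬ : ℕ → Vec m →ₗ[ℝ] Vec n} {k : ℕ}
    {w : ℕ → Vec n} {u : ℕ → Vec m} (h0 : w 0 = 0) (h : Evolves 𝒜 ℬ 0 k w u 0) :
    ∀ j ≤ k, w j = orbit 𝒜 (fun j => ℬ j (u j)) 0 j
  | 0, _ => h0
  | j + 1, hj => by
    rw [h j hj, eq_orbit_of_evolves h0 h j (by omega), orbit]
    simp

/-- The minimizers of the problem with a terminal constraint are critical, for a suitable
multiplier. -/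
theorem SolvesTerminal.exists_isCritical (W : WellConditioned T f c mf lf mc lc)
    (H : UniformlyControllable T A B d a b σ) (hσ : 0 < σ) (hdp : d ≤ p) (htp : t + p ≤ T)
    {x z : Vec n} {ζ : Fin p → Vec n} {s : Traj n m p}
    (hs : SolvesTerminal A B f c t x ζ z s) : ∃ q, IsCritical A B f c t x ζ s q := by
  have key : ∀ w u, w 0 = 0 → Evolves (mapsFrom A t) (mapsFrom B t) 0 p w u 0 → w p = 0 →
      variation f c t p (extend s.1) (extend s.2) w u = 0 := by
    intro w u h0 hw hwp
    refine IsLocalMin.hasDerivAt_eq_zero (Filter.Eventually.of_forall fun ε => ?_)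
      (hasDerivAt_stageCost W htp s w u)
    have := hs.2 ⟨add_smul_mem_feasible hs.1.1 h0 hw ε, by
      have : s.1 (Fin.last p) = z := hs.1.2
      simp [restrict, hwp, this]⟩
    simpa using this
  set Λ := zeroStateResponse (mapsFrom A t) (mapsFrom B t) with hΛ
  let Ψ : (ℕ → Vec m) →ₗ[ℝ] ℝ := ∑ j ∈ range p,
    (innerₗ (Vec n) (gradient (f (t + j + 1)) (extend s.1 (j + 1))) ∘ₗ Λ (j + 1) +
      innerₗ (Vec m) (gradient (c (t + j + 1)) (extend s.2 j)) ∘ₗ LinearMap.proj j)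
  have hΨ : ∀ u, Ψ u = variation f c t p (extend s.1) (extend s.2)
      (orbit (mapsFrom A t) (fun j => mapsFrom B t j (u j)) 0) u := by
    intro u
    simp [Ψ, variation, hΛ, zeroStateResponse_apply]
  obtain ⟨q, hq⟩ := exists_multiplier (Λ p) (fun e => by
    obtain ⟨u, hu, -⟩ := H.exists_control hσ hdp htp e
    exact ⟨u, by rw [hΛ, zeroStateResponse_apply, hu]⟩) Ψ (fun u hu => by
      rw [hΛ, zeroStateResponse_apply] at hu
      rw [hΨ]
      have := orbit_evolves (mapsFrom A t) (mapsFrom B t) u 0 0 p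
      rw [zero_add] at this
      exact key _ u rfl this hu)
  refine ⟨-q, hs.1.1, fun w u h0 hw => ?_⟩
  have h1 := eq_orbit_of_evolves h0 hw
  have h2 : variation f c t p (extend s.1) (extend s.2) w u = Ψ u := by
    rw [hΨ]
    unfold variation
    refine sum_congr rfl fun j hj => ?_
    rw [h1 (j + 1) (mem_range.1 hj)]
  rw [h2, hq, hΛ, zeroStateResponse_apply, h1 p le_rfl, inner_neg_left, add_neg_cancel]

/-- The difference of two critical trajectories solves the optimality system `Extremal`. -/
theorem IsCritical.exists_extremal (W : WellConditioned T f c mf lf mc lc) (hmf : 0 < mf)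
    (hlf : 0 < lf) (hmc : 0 < mc) (htp : t + p ≤ T) (hp : 1 ≤ p) {x x' : Vec n}
    {ζ ζ' : Fin p → Vec n} {s s' : Traj n m p} {q q' : Vec n}
    (hs : IsCritical A B f c t x ζ s q) (hs' : IsCritical A B f c t x' ζ' s' q') :
    ∃ k g r, Extremal (mapsFrom A t) (mapsFrom B t) p mf (max lf lc) (extend (s.1 - s'.1))
        (extend (s.2 - s'.2)) (extend (ζ - ζ')) k g r ∧
      (mf * ‖extend (s.1 - s'.1) p‖ ^ 2 + inner ℝ (q - q') (extend (s.1 - s'.1) p) ≤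
        inner ℝ (k p) (extend (s.1 - s'.1) p)) ∧
      ∀ j < p, mc * ‖extend (s.2 - s'.2) j‖ ^ 2 ≤ inner ℝ (r j) (extend (s.2 - s'.2) j) := by
  set y := extend (s.1 - s'.1) with hy
  set v := extend (s.2 - s'.2) with hv
  have hl : 0 < max lf lc := lt_max_of_lt_left hlf
  have ey : ∀ j, y j = extend s.1 j - extend s'.1 j := extend_sub _ _
  have ev : ∀ j, v j = extend s.2 j - extend s'.2 j := extend_sub _ _
  let G : ℕ → Vec n := fun j =>
    gradient (f (t + j)) (extend s.1 j) - gradient (f (t + j)) (extend s'.1 j)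
  let g : ℕ → Vec n := fun j => if j = 0 then mf • y 0 else G j
  let r : ℕ → Vec m := fun j =>
    gradient (c (t + j + 1)) (extend s.2 j) - gradient (c (t + j + 1)) (extend s'.2 j)
  obtain ⟨k, hkp, hk⟩ := exists_costate (mapsFrom A t) g p (G p + (q - q'))
  refine ⟨k, g, r, ⟨?_, hk, ?_, by simp [g], ?_, ?_, ?_⟩, ?_, ?_⟩
  · intro j hj
    rw [ey, ey, ev, extend_sub, evolves_of_mem_feasible hs.feasible j hj,
      evolves_of_mem_feasible hs'.feasible j hj, map_sub, map_sub]
    abel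
  · intro j hj e
    -- test stationarity with a control that acts at time `j` only
    set u : ℕ → Vec m := Pi.single j e with hu
    set w := orbit (mapsFrom A t) (fun j => mapsFrom B t j (u j)) 0 with hw
    have hev : Evolves (mapsFrom A t) (mapsFrom B t) 0 p w u 0 := by
      have := orbit_evolves (mapsFrom A t) (mapsFrom B t) u 0 0 p
      rwa [zero_add] at this
    have h1 := hs.stationary w u rfl hev
    have h2 := hs'.stationary w u rfl hev
    have h3 := costate_pairing hk (fun j => mapsFrom B t j (u j)) le_rfl
    have h4 : ∑ i ∈ range p, inner ℝ (k (i + 1)) (mapsFrom B t i (u i)) =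
        inner ℝ (k (j + 1)) (mapsFrom B t j e) := by
      rw [sum_eq_single j]
      · simp [hu]
      · intro i _ hij
        simp [hu, Pi.single_eq_of_ne hij]
      · intro h
        simp [hj] at h
    have h5 : ∑ i ∈ range p, inner ℝ (r i) (u i) = inner ℝ (r j) e := by
      rw [sum_eq_single j]
      · simp [hu]
      · intro i _ hij
        simp [hu, Pi.single_eq_of_ne hij]
      · intro h
        simp [hj] at h
    have h6 : ∑ i ∈ range p, inner ℝ (G (i + 1)) (w (i + 1)) =
        ∑ i ∈ range p, inner ℝ (g i) (w i) + inner ℝ (G p) (w p) := by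
      obtain ⟨p, rfl⟩ : ∃ p', p = p' + 1 := ⟨p - 1, by omega⟩
      rw [sum_range_succ, sum_range_succ' (fun i => inner ℝ (g i) (w i))]
      have : w 0 = 0 := rfl
      simp [g, this]
    have h7 : variation f c t p (extend s.1) (extend s.2) w u -
        variation f c t p (extend s'.1) (extend s'.2) w u =
        ∑ i ∈ range p, inner ℝ (G (i + 1)) (w (i + 1)) + ∑ i ∈ range p, inner ℝ (r i) (u i) := by
      unfold variation
      rw [← sum_sub_distrib, ← sum_add_distrib]
      refine sum_congr rfl fun i _ => ?_
      simp only [G, r, inner_sub_left, add_assoc]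
      ring
    rw [hkp, inner_add_left, inner_sub_left q q'] at h3
    rw [← hw] at h3
    linarith
  · intro j hj0 hj
    have := (W.f_convex (t + j) (by omega) (by omega)).cocoercive hmf
      ((W.f_smooth (t + j) (by omega) (by omega)).mono (le_max_left lf lc)) hl
      (extend s.1 j) (extend s'.1 j)
    simpa only [g, if_neg hj0.ne', ey] using this
  · intro j hj
    by_cases hj0 : j = 0
    · simp [g, hj0]
    · have := (W.f_convex (t + j) (by omega) (by omega)).cocoercive_sub hmf
        ((W.f_smooth (t + j) (by omega) (by omega)).mono (le_max_left lf lc)) hl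
        (extend s.1 j) (extend s'.1 j)
      simpa only [g, if_neg hj0, ey] using this
  · intro j hj
    have := (W.c_convex (t + j + 1) (by omega) (by omega)).cocoercive hmc
      ((W.c_smooth (t + j + 1) (by omega) (by omega)).mono (le_max_right lf lc)) hl
      (extend s.2 j) (extend s'.2 j)
    simpa only [r, ev] using this
  · have := (W.f_convex (t + p) (by omega) (by omega)).norm_sq_le (extend s.1 p) (extend s'.1 p)
    rw [hkp, inner_add_left]
    simp only [ey, G]
    linarith
  · intro j hj
    have := (W.c_convex (t + j + 1) (by omega) (by omega)).norm_sq_le (extend s.2 j) (extend s'.2 j)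
    simpa only [r, ev] using this

/-- A critical trajectory is determined by the data, if the terminal condition is monotone. -/
theorem IsCritical.unique (W : WellConditioned T f c mf lf mc lc) (hmf : 0 < mf) (hlf : 0 < lf)
    (hmc : 0 < mc) (htp : t + p ≤ T) (hp : 1 ≤ p) {x : Vec n} {ζ : Fin p → Vec n}
    {s s' : Traj n m p} {q q' : Vec n} (hs : IsCritical A B f c t x ζ s q)
    (hs' : IsCritical A B f c t x ζ s' q')
    (hq : 0 ≤ inner ℝ (q - q') (s.1 (Fin.last p) - s'.1 (Fin.last p))) : s = s' := by
  obtain ⟨k, g, r, H, hT, hr⟩ := hs.exists_extremal W hmf hlf hmc htp hp hs'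
  have hl : 0 < max lf lc := lt_max_of_lt_left hlf
  have h1 := H.energy_of_undisturbed (i := 0) (k := p) (by omega) (fun j _ => by simp [extend])
  have h0 : extend (s.1 - s'.1) 0 = 0 := by simp [hs.feasible.1, hs'.feasible.1]
  rw [h0, inner_zero_right] at h1
  simp only [zero_add] at h1
  have hq' : 0 ≤ inner ℝ (q - q') (extend (s.1 - s'.1) p) := by
    rw [extend_last]
    exact hq
  have hyp : 0 ≤ mf * ‖extend (s.1 - s'.1) p‖ ^ 2 := by positivity
  have hnn : ∀ j ∈ range p, 0 ≤ dissipation (extend (s.1 - s'.1)) (extend (s.2 - s'.2)) g r j :=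
    fun j hj => H.dissipation_nonneg hl hmf (mem_range.1 hj)
  have hsum := sum_nonneg hnn
  have hz := (sum_eq_zero_iff_of_nonneg hnn).1 (by linarith)
  have hy : ∀ j ≤ p, extend (s.1 - s'.1) j = 0 := by
    intro j hj
    rw [← norm_eq_zero, ← sq_eq_zero_iff]
    refine le_antisymm ?_ (sq_nonneg _)
    refine le_of_mul_le_mul_left (a := mf) ?_ hmf
    rw [mul_zero]
    rcases hj.eq_or_lt with rfl | hj
    · linarith
    · exact (H.norm_sq_le_dissipation hl hj).trans (hz j (mem_range.2 hj)).le
  have hv : ∀ j < p, extend (s.2 - s'.2) j = 0 := by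
    intro j hj
    have h2 := hz j (mem_range.2 hj)
    rw [dissipation, hy j hj.le, inner_zero_right, zero_add] at h2
    have h3 := hr j hj
    rw [h2] at h3
    rw [← norm_eq_zero, ← sq_eq_zero_iff]
    exact le_antisymm (le_of_mul_le_mul_left (by rwa [mul_zero]) hmc) (sq_nonneg _)
  refine Prod.ext (funext fun j => ?_) (funext fun j => ?_)
  · have := hy j (by omega)
    rwa [extend_val, Pi.sub_apply, sub_eq_zero] at this
  · have := hv j j.2
    rwa [extend_val, Pi.sub_apply, sub_eq_zero] at this

end Problem

/-! ### Existence, uniqueness and perturbation bounds -/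

section Main

variable {n m : ℕ} {T : ℕ} {A : ℕ → Matrix (Fin n) (Fin n) ℝ} {B : ℕ → Matrix (Fin n) (Fin m) ℝ}
  {f : ℕ → Vec n → ℝ} {c : ℕ → Vec m → ℝ} {mf lf mc lc a b σ : ℝ} {d t p : ℕ}

theorem isClosed_feasible (x : Vec n) (ζ : Fin p → Vec n) :
    IsClosed (feasible A B t x ζ : Set (Traj n m p)) := by
  have h1 : ∀ {k : ℕ} (M : Matrix (Fin n) (Fin k) ℝ), Continuous (Matrix.toEuclideanLin M) :=
    fun M => LinearMap.continuous_of_finiteDimensional _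
  have e : (feasible A B t x ζ : Set (Traj n m p)) = {s | s.1 0 = x} ∩ ⋂ τ : Fin p,
      {s | s.1 τ.succ = Matrix.toEuclideanLin (A (t + τ)) (s.1 τ.castSucc) +
        Matrix.toEuclideanLin (B (t + τ)) (s.2 τ) + ζ τ} := by
    ext s
    simp [feasible]
  rw [e]
  refine (isClosed_eq (by fun_prop) continuous_const).inter (isClosed_iInter fun τ => ?_)
  refine isClosed_eq (by fun_prop) ?_
  exact (((h1 _).comp (by fun_prop)).add ((h1 _).comp (by fun_prop))).add continuous_const

theorem WellConditioned.continuous_stageCost (W : WellConditioned T f c mf lf mc lc)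
    (htp : t + p ≤ T) : Continuous (stageCost f c t : Traj n m p → ℝ) := by
  unfold stageCost
  refine (continuous_finsetSum _ fun j _ => ?_).add (continuous_finsetSum _ fun j _ => ?_)
  · exact (W.differentiable_f (t := t + j + 1) (by omega) (by omega)).continuous.comp
      (by fun_prop)
  · exact (W.differentiable_c (t := t + j + 1) (by omega) (by omega)).continuous.comp
      (by fun_prop)

/-- The accumulated stage costs dominate the squared size of every later state and control. -/
theorem WellConditioned.norm_sq_le_stageCost (W : WellConditioned T f c mf lf mc lc)
    (htp : t + p ≤ T) (s : Traj n m p) :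
    (∀ j, mf / 2 * ‖s.1 (Fin.succ j)‖ ^ 2 ≤ stageCost f c t s) ∧
      ∀ j, mc / 2 * ‖s.2 j‖ ^ 2 ≤ stageCost f c t s := by
  have hf : ∀ j ∈ (univ : Finset (Fin p)), 0 ≤ f (t + j + 1) (s.1 j.succ) := fun j _ =>
    W.f_nonneg _ (by omega) (by omega) _
  have hc : ∀ j ∈ (univ : Finset (Fin p)), 0 ≤ c (t + j + 1) (s.2 j) := fun j _ =>
    W.c_nonneg _ (by omega) (by omega) _
  have hfs := sum_nonneg hf
  have hcs := sum_nonneg hc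
  unfold stageCost
  refine ⟨fun j => ?_, fun j => ?_⟩
  · have h1 := (W.f_convex (t + j + 1) (by omega) (by omega)).le_of_nonneg
      (W.f_zero _ (by omega) (by omega)) (W.f_nonneg _ (by omega) (by omega)) (s.1 j.succ)
    have h2 := single_le_sum hf (mem_univ j)
    linarith
  · have h1 := (W.c_convex (t + j + 1) (by omega) (by omega)).le_of_nonneg
      (W.c_zero _ (by omega) (by omega)) (W.c_nonneg _ (by omega) (by omega)) (s.2 j)
    have h2 := single_le_sum hc (mem_univ j)
    linarith

/-- Existence of a minimizer, by coercivity. -/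
theorem WellConditioned.exists_isMinOn (W : WellConditioned T f c mf lf mc lc) (hmf : 0 < mf)
    (hmc : 0 < mc) (htp : t + p ≤ T) {x : Vec n} {ζ : Fin p → Vec n} {K : Set (Traj n m p)}
    (hK : IsClosed K) (hne : K.Nonempty) (hsub : K ⊆ feasible A B t x ζ) {g : Vec n → ℝ}
    (hg : Continuous g) (hg0 : ∀ x, 0 ≤ g x) :
    ∃ s ∈ K, IsMinOn (fun r : Traj n m p => stageCost f c t r + g (r.1 (Fin.last p))) K s := by
  obtain ⟨s₀, hs₀⟩ := hne
  refine ContinuousOn.exists_isMinOn'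
    ((W.continuous_stageCost htp).add (hg.comp (by fun_prop))).continuousOn hK hs₀ ?_
  set J := stageCost f c t s₀ + g (s₀.1 (Fin.last p)) with hJ
  set R := max ‖x‖ (max √(2 * J / mf) √(2 * J / mc)) with hR
  have hR0 : 0 ≤ R := le_max_of_le_left (norm_nonneg _)
  rw [Filter.eventually_inf_principal]
  filter_upwards [(isCompact_closedBall (0 : Traj n m p) R).compl_mem_cocompact] with s hs hsK
  by_contra! hlt
  refine hs ?_
  have h1 := hg0 (s.1 (Fin.last p))
  obtain ⟨h2, h3⟩ := W.norm_sq_le_stageCost htp s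
  rw [mem_closedBall_zero_iff, Prod.norm_def, max_le_iff, pi_norm_le_iff_of_nonneg hR0,
    pi_norm_le_iff_of_nonneg hR0]
  refine ⟨fun j => ?_, fun j => ?_⟩
  · refine Fin.cases ?_ (fun j => ?_) j
    · rw [(hsub hsK).1]
      exact le_max_left _ _
    · refine (Real.le_sqrt_of_sq_le ?_).trans
        ((le_max_left _ _).trans (le_max_right _ _))
      rw [le_div_iff₀ hmf]
      have := h2 j
      linarith
  · refine (Real.le_sqrt_of_sq_le ?_).trans
      ((le_max_right _ _).trans (le_max_right _ _))
    rw [le_div_iff₀ hmc]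
    have := h3 j
    linarith

theorem UniformlyControllable.exists_feasible (H : UniformlyControllable T A B d a b σ)
    (hσ : 0 < σ) (hdp : d ≤ p) (htp : t + p ≤ T) (x : Vec n) (ζ : Fin p → Vec n) (z : Vec n) :
    (feasible A B t x ζ ∩ {r : Traj n m p | r.1 (Fin.last p) = z}).Nonempty := by
  obtain ⟨u, hu, -⟩ := H.exists_control hσ hdp htp (z - orbit (mapsFrom A t) (extend ζ) x p)
  refine ⟨restrict p (orbit (mapsFrom A t) (extend ζ + fun j => mapsFrom B t j (u j)) x) u,
    mem_feasible_restrict rfl (orbit_evolves _ _ u _ x p), ?_⟩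
  have := orbit_add (mapsFrom A t) (extend ζ) (fun j => mapsFrom B t j (u j)) x 0 p
  rw [add_zero, hu, add_sub_cancel] at this
  exact this

/-- Uniqueness and decay for a problem whose solutions are critical with a monotone terminal
condition. The data are changed one at a time. -/
theorem unique_and_decay (W : WellConditioned T f c mf lf mc lc)
    (H : UniformlyControllable T A B d a b σ) (hmf : 0 < mf) (hlf : 0 < lf) (hmc : 0 < mc)
    (ha : 0 < a) (hb : 0 < b) (hσ : 0 < σ) (hd : 1 ≤ d) (hdp : d ≤ p) (htp : t + p ≤ T)
    {Sol : Vec n → (Fin p → Vec n) → Traj n m p → Prop} (hex : ∀ x ζ, ∃ s, Sol x ζ s)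
    (hcrit : ∀ {x x' ζ ζ' s s'}, Sol x ζ s → Sol x' ζ' s' → ∃ q q',
      IsCritical A B f c t x ζ s q ∧ IsCritical A B f c t x' ζ' s' q' ∧
        0 ≤ inner ℝ (q - q') (s.1 (Fin.last p) - s'.1 (Fin.last p))) :
    (∀ x ζ, ∃! s, Sol x ζ s) ∧ ∀ {x x' ζ ζ' s s'}, Sol x ζ s → Sol x' ζ' s' →
      ∀ h : Fin (p + 1), ‖s.1 h - s'.1 h‖ ≤ bigC mf lf mc lc a b σ d *
        (rate mf lf mc lc a b σ d ^ (h : ℕ) * ‖x - x'‖ +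
          ∑ τ : Fin p, rate mf lf mc lc a b σ d ^ ((h : ℤ) - (τ : ℤ)).natAbs * ‖ζ τ - ζ' τ‖) := by
  have hl : 0 < max lf lc := lt_max_of_lt_left hlf
  have R := (rates (lc := lc) ha hb hσ hmf hlf hmc hd).1
  have hst := H.steerable (mc := mc) (lc := lc) ha hb hσ hlf hmc htp
  have hab := H.absorbing (mc := mc) (lc := lc) ha hb hσ hlf hmc htp
  set C := bigC mf lf mc lc a b σ d
  set lam := rate mf lf mc lc a b σ d
  have huniq : ∀ {x ζ s s'}, Sol x ζ s → Sol x ζ s' → s = s' := by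
    intro x ζ s s' hs hs'
    obtain ⟨q, q', h1, h2, h3⟩ := hcrit hs hs'
    exact h1.unique W hmf hlf hmc htp (by omega) h2 h3
  refine ⟨fun x ζ => ?_, ?_⟩
  · obtain ⟨s, hs⟩ := hex x ζ
    exact ⟨s, hs, fun s' hs' => huniq hs' hs⟩
  have key : ∀ {x x' ζ ζ' s s'}, Sol x ζ s → Sol x' ζ' s' → ∃ k g r,
      Extremal (mapsFrom A t) (mapsFrom B t) p mf (max lf lc) (extend (s.1 - s'.1))
        (extend (s.2 - s'.2)) (extend (ζ - ζ')) k g r ∧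
      mf * ‖extend (s.1 - s'.1) p‖ ^ 2 ≤ inner ℝ (k p) (extend (s.1 - s'.1) p) ∧
      extend (s.1 - s'.1) 0 = x - x' := by
    intro x x' ζ ζ' s s' hs hs'
    obtain ⟨q, q', h1, h2, h3⟩ := hcrit hs hs'
    obtain ⟨k, g, r, hE, hT, -⟩ := h1.exists_extremal W hmf hlf hmc htp (by omega) h2
    refine ⟨k, g, r, hE, ?_, ?_⟩
    · have : 0 ≤ inner ℝ (q - q') (extend (s.1 - s'.1) p) := by
        rw [extend_last]
        exact h3
      linarith
    · rw [extend_zero, Pi.sub_apply, h1.feasible.1, h2.feasible.1]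
  intro x x' ζ ζ' s s' hs hs' h
  have hinit : ∀ {x x' ζ s s'}, Sol x ζ s → Sol x' ζ s' →
      ‖s.1 h - s'.1 h‖ ≤ C * (lam ^ (h : ℕ) * ‖x - x'‖) := by
    intro x x' ζ s s' hs hs'
    obtain ⟨k, g, r, hE, hT, h0⟩ := key hs hs'
    have := hE.norm_le_of_initial R hl hst hdp (fun j _ => by simp [extend]) hT
      (h := h) (by omega)
    rwa [h0, extend_val] at this
  have himp : ∀ {x ζ τ e s s'}, Sol x (Function.update ζ τ e) s → Sol x ζ s' →
      ‖s.1 h - s'.1 h‖ ≤ C * lam ^ ((h : ℤ) - (τ : ℤ)).natAbs * ‖e - ζ τ‖ := by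
    intro x ζ τ e s s' hs hs'
    obtain ⟨k, g, r, hE, hT, h0⟩ := key hs hs'
    have := hE.norm_le_of_impulse R hl hst hab hdp (by rw [h0, sub_self]) τ.2 (fun j hj hjτ => by
      have : (⟨j, hj⟩ : Fin p) ≠ τ := fun h => hjτ (congrArg Fin.val h)
      simp [extend, hj, Function.update_of_ne this]) hT (h := h) (by omega)
    simp only [extend_val, Pi.sub_apply, Function.update_self] at this
    rwa [mul_assoc]
  choose S hS using hex
  have h1 := hinit (hS x ζ) (hS x' ζ)
  have h2 := norm_sub_le_sum_of_update (fun ζ => (S x' ζ).1 h)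
    (fun τ : Fin p => C * lam ^ ((h : ℤ) - (τ : ℤ)).natAbs)
    (fun ζ τ e => himp (hS x' (Function.update ζ τ e)) (hS x' ζ)) ζ ζ'
  rw [huniq hs (hS x ζ), huniq hs' (hS x' ζ')]
  refine (norm_sub_le_norm_sub_add_norm_sub _ ((S x' ζ).1 h) _).trans
    ((add_le_add h1 h2).trans_eq ?_)
  rw [mul_add, mul_sum]
  simp only [mul_assoc]

theorem WellConditioned.exists_solvesTerminal (W : WellConditioned T f c mf lf mc lc)
    (H : UniformlyControllable T A B d a b σ) (hmf : 0 < mf) (hmc : 0 < mc) (hσ : 0 < σ)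
    (hdp : d ≤ p) (htp : t + p ≤ T) (x : Vec n) (ζ : Fin p → Vec n) (z : Vec n) :
    ∃ s : Traj n m p, SolvesTerminal A B f c t x ζ z s := by
  obtain ⟨s, hs, hmin⟩ := W.exists_isMinOn hmf hmc htp
    ((isClosed_feasible x ζ).inter (isClosed_eq (by fun_prop) continuous_const))
    (H.exists_feasible (B := B) hσ hdp htp x ζ z) Set.inter_subset_left
    (g := fun _ => 0) continuous_const (fun _ => le_rfl)
  exact ⟨s, hs, by simpa using hmin⟩

theorem solvesCost_coe_iff {g : Vec n → ℝ} {x : Vec n} {ζ : Fin p → Vec n} {s : Traj n m p} :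
    SolvesCost A B f c (fun x => (g x : EReal)) t x ζ s ↔ s ∈ feasible A B t x ζ ∧
      IsMinOn (fun r : Traj n m p => stageCost f c t r + g (r.1 (Fin.last p)))
        (feasible A B t x ζ) s := by
  unfold SolvesCost
  simp only [isMinOn_iff, ← EReal.coe_add, EReal.coe_le_coe_iff]

@[simp]
theorem indicatorZero_zero : indicatorZero n 0 = 0 := if_pos rfl

theorem indicatorZero_of_ne {y : Vec n} (hy : y ≠ 0) : indicatorZero n y = ⊤ := if_neg hy

/-- With the indicator function of the origin as terminal cost, the problem is the one with the
terminal constraint `y_p = 0`, because that constraint can be met. -/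
theorem solvesCost_indicatorZero_iff {x : Vec n} {ζ : Fin p → Vec n} {s : Traj n m p}
    (hne : (feasible A B t x ζ ∩ {r : Traj n m p | r.1 (Fin.last p) = 0}).Nonempty) :
    SolvesCost A B f c (indicatorZero n) t x ζ s ↔ SolvesTerminal A B f c t x ζ 0 s := by
  unfold SolvesCost SolvesTerminal
  simp only [isMinOn_iff]
  constructor
  · rintro ⟨hs, hmin⟩
    have h0 : s.1 (Fin.last p) = 0 := by
      by_contra h
      obtain ⟨r, hr, hr0⟩ := hne
      have := hmin r hr
      rw [Set.mem_ofPred_eq] at hr0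
      rw [indicatorZero_of_ne h, hr0, indicatorZero_zero, add_zero, EReal.coe_add_top, top_le_iff] at this
      exact EReal.coe_ne_top _ this
    refine ⟨⟨hs, h0⟩, fun r hr => ?_⟩
    have := hmin r hr.1
    have hr0 : r.1 (Fin.last p) = 0 := hr.2
    rw [h0, hr0, indicatorZero_zero, add_zero, add_zero, EReal.coe_le_coe_iff] at this
    exact this
  · rintro ⟨⟨hs, h0⟩, hmin⟩
    refine ⟨hs, fun r hr => ?_⟩
    rw [Set.mem_ofPred_eq] at h0
    rw [h0, indicatorZero_zero, add_zero]
    by_cases hr0 : r.1 (Fin.last p) = 0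
    · rw [hr0, indicatorZero_zero, add_zero, EReal.coe_le_coe_iff]
      exact hmin r ⟨hr, hr0⟩
    · rw [indicatorZero_of_ne hr0, EReal.coe_add_top]
      exact le_top

end Main

end LTV

theorem theorem2 {n m : ℕ} (T : ℕ)
    (A : ℕ → Matrix (Fin n) (Fin n) ℝ) (B : ℕ → Matrix (Fin n) (Fin m) ℝ)
    (f : ℕ → LTV.Vec n → ℝ) (c : ℕ → LTV.Vec m → ℝ)
    (mf lf mc lc a b σ : ℝ) (d : ℕ)
    (hmf : 0 < mf) (hlf : 0 < lf) (hmc : 0 < mc) (hlc : 0 < lc)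
    (ha : 0 < a) (hb : 0 < b) (hσ : 0 < σ) (hd : 1 ≤ d)
    (hcost : LTV.WellConditioned T f c mf lf mc lc)
    (hctrb : LTV.UniformlyControllable T A B d a b σ)
    (F : LTV.Vec n → EReal) (hF : LTV.IsTerminalCost F)
    (C lam : ℝ) (hC : C = LTV.bigC mf lf mc lc a b σ d)
    (hlam : lam = LTV.rate mf lf mc lc a b σ d) :
    (0 < lam ∧ lam < 1) ∧
    ∀ t p : ℕ, d ≤ p → t + p ≤ T →
      -- both problems have a unique solution
      (∀ (x : LTV.Vec n) (ζ : Fin p → LTV.Vec n),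
        ∃! s : LTV.Traj n m p, LTV.SolvesCost A B f c F t x ζ s) ∧
      (∀ (x : LTV.Vec n) (ζ : Fin p → LTV.Vec n) (z : LTV.Vec n),
        ∃! s : LTV.Traj n m p, LTV.SolvesTerminal A B f c t x ζ z s) ∧
      -- perturbation bound for the problem with terminal cost
      (∀ (x x' : LTV.Vec n) (ζ ζ' : Fin p → LTV.Vec n) (s s' : LTV.Traj n m p),
        LTV.SolvesCost A B f c F t x ζ s → LTV.SolvesCost A B f c F t x' ζ' s' →
        ∀ h : Fin (p + 1),
          ‖s.1 h - s'.1 h‖ ≤ C * (lam ^ (h : ℕ) * ‖x - x'‖ +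
            ∑ τ : Fin p, lam ^ ((h : ℤ) - (τ : ℤ)).natAbs * ‖ζ τ - ζ' τ‖)) ∧
      -- perturbation bound for the problem with terminal constraint
      (∀ (x x' : LTV.Vec n) (ζ ζ' : Fin p → LTV.Vec n) (z z' : LTV.Vec n)
        (s s' : LTV.Traj n m p),
        LTV.SolvesTerminal A B f c t x ζ z s → LTV.SolvesTerminal A B f c t x' ζ' z' s' →
        ∀ h : Fin (p + 1),
          ‖s.1 h - s'.1 h‖ ≤ C * (lam ^ (h : ℕ) * ‖x - x'‖ +
            ∑ τ : Fin p, lam ^ ((h : ℤ) - (τ : ℤ)).natAbs * ‖ζ τ - ζ' τ‖ +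
            lam ^ (p - (h : ℕ)) * ‖z - z'‖)) := by
  have hR := LTV.rates (lc := lc) ha hb hσ hmf hlf hmc hd
  subst hC hlam
  refine ⟨⟨hR.1.lam_pos, hR.2⟩, fun t p hdp htp => ?_⟩
  have hl : 0 < max lf lc := lt_max_of_lt_left hlf
  have hexT := hcost.exists_solvesTerminal (t := t) (p := p) hctrb hmf hmc hσ hdp htp
  have hT := fun z => LTV.unique_and_decay hcost hctrb hmf hlf hmc ha hb hσ hd hdp htp
    (Sol := fun x ζ s => LTV.SolvesTerminal A B f c t x ζ z s) (fun x ζ => hexT x ζ z) (by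
      intro x x' ζ ζ' s s' hs hs'
      obtain ⟨q, hq⟩ := hs.exists_isCritical hcost hctrb hσ hdp htp
      obtain ⟨q', hq'⟩ := hs'.exists_isCritical hcost hctrb hσ hdp htp
      have h1 : s.1 (Fin.last p) = z := hs.1.2
      have h2 : s'.1 (Fin.last p) = z := hs'.1.2
      exact ⟨q, q', hq, hq', by rw [h1, h2, sub_self, inner_zero_right]⟩)
  have hCost : (∀ x ζ, ∃! s : LTV.Traj n m p, LTV.SolvesCost A B f c F t x ζ s) ∧
      ∀ {x x' ζ ζ'} {s s' : LTV.Traj n m p}, LTV.SolvesCost A B f c F t x ζ s →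
        LTV.SolvesCost A B f c F t x' ζ' s' → ∀ h : Fin (p + 1),
        ‖s.1 h - s'.1 h‖ ≤ LTV.bigC mf lf mc lc a b σ d *
          (LTV.rate mf lf mc lc a b σ d ^ (h : ℕ) * ‖x - x'‖ +
            ∑ τ : Fin p,
              LTV.rate mf lf mc lc a b σ d ^ ((h : ℤ) - (τ : ℤ)).natAbs * ‖ζ τ - ζ' τ‖) := by
    rcases hF with rfl | ⟨g, rfl, hg0, hgc, hgd, -⟩
    · simp only [LTV.solvesCost_indicatorZero_iff (hctrb.exists_feasible hσ hdp htp _ _ _)]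
      exact hT 0
    · have hgd' : Differentiable ℝ g := hgd.differentiable (by norm_num)
      refine LTV.unique_and_decay hcost hctrb hmf hlf hmc ha hb hσ hd hdp htp (fun x ζ => ?_) ?_
      · obtain ⟨s, hs, hmin⟩ := hcost.exists_isMinOn hmf hmc htp (LTV.isClosed_feasible x ζ)
          ((hctrb.exists_feasible (B := B) hσ hdp htp x ζ 0).mono Set.inter_subset_left)
          subset_rfl hgd'.continuous hg0
        exact ⟨s, LTV.solvesCost_coe_iff.2 ⟨hs, hmin⟩⟩
      · intro x x' ζ ζ' s s' hs hs'
        obtain ⟨h1, h2⟩ := LTV.solvesCost_coe_iff.1 hs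
        obtain ⟨h1', h2'⟩ := LTV.solvesCost_coe_iff.1 hs'
        exact ⟨_, _, LTV.isCritical_of_isMinOn hcost htp hgd' h1 h2,
          LTV.isCritical_of_isMinOn hcost htp hgd' h1' h2',
          LTV.inner_gradient_sub_nonneg_of_convexOn hgc hgd' _ _⟩
  refine ⟨hCost.1, fun x ζ z => (hT z).1 x ζ, fun x x' ζ ζ' s s' hs hs' h => hCost.2 hs hs' h, ?_⟩
  intro x x' ζ ζ' z z' s s' hs hs' h
  -- intermediate problem: new initial state and disturbances, old terminal state
  obtain ⟨r, hr⟩ := hexT x' ζ' z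
  have h1 := (hT z).2 hs hr h
  have h2 : ‖r.1 h - s'.1 h‖ ≤ LTV.bigC mf lf mc lc a b σ d *
      (LTV.rate mf lf mc lc a b σ d ^ (p - (h : ℕ)) * ‖z - z'‖) := by
    obtain ⟨q, hq⟩ := hr.exists_isCritical hcost hctrb hσ hdp htp
    obtain ⟨q', hq'⟩ := hs'.exists_isCritical hcost hctrb hσ hdp htp
    obtain ⟨k, g, w, hE, -⟩ := hq.exists_extremal hcost hmf hlf hmc htp (by omega) hq'
    have h3 := hE.norm_le_of_terminal hR.1 hl (hctrb.steerable ha hb hσ hlf hmc htp) hdp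
      (fun j _ => by simp [LTV.extend])
      (by rw [LTV.extend_zero, Pi.sub_apply, hq.feasible.1, hq'.feasible.1, sub_self])
      (h := h) (by omega)
    have hz : r.1 (Fin.last p) = z := hr.1.2
    have hz' : s'.1 (Fin.last p) = z' := hs'.1.2
    rwa [LTV.extend_val, LTV.extend_last, Pi.sub_apply, Pi.sub_apply, hz, hz'] at h3
  refine (norm_sub_le_norm_sub_add_norm_sub _ (r.1 h) _).trans ((add_le_add h1 h2).trans_eq ?_)
  ring
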